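/- Let $(\mathsf S,\preceq)$ be a finite poset with an injective map $v:\mathsf S\hookrightarrow\{1,\dots,m\}$ such that $s\succ t$ implies $v(s)<v(t)$, and such that $v(s)<v(t)<v(r)$ and $s\succ r$ imply $t\succ r$ (an arborescent poset with consistent anti-linearization). Put $n=\#\mathsf S$ and let $\lambda=(\lambda_1>\dots>\lambda_n\ge 0)$ be a regular partition, padded by $m-n$ zeros to length $m$. Let $\mathbb S_m\lambda$ be the set of rearrangements $d=(d_1,\dots,d_m)$ of $\lambda$ with the (strong) Bruhat order $\preceq_{\mathrm{Br}}$, the partial order generated by the relations $d\prec (ij)d$ for $i<j$, $d_i>d_j$, where $(ij)d$ is $d$ with its $i$-th and $j$-th entries exchanged. The order is induced on the following subsets: * $\mathsf A_{\mathsf S}$, the $\mathsf S$-admissible $d\in\mathbb S_m\lambda$: for every $k$, $\#\{j\le k: d_j>0\}\le\#\{s\in\mathsf S: v(s)\le k\}$; * $\mathsf D_{\mathsf S}$, the $\mathsf S$-dominant $d\in\mathbb S_m\lambda$: $d_l=0$ for $l\notin v(\mathsf S)$, and $d_{v(s)}\ge d_{v(t)}$ whenever $s\succ t$. A minimal $\mathsf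 S$-disorder of $d\in\mathsf D_{\mathsf S}$ is a pair $(ij)=(v(s),v(t))$, where $s,t\in\mathsf S$ are incomparable, $i<j$ and $d_i>d_j$, such that every $r\in\mathsf S$ with $i<v(r)<j$ satisfies: $d_{v(r)}\le d_j$ if $r\prec s$; $d_{v(r)}\ge d_i$ if $r\succ t$; $d_{v(r)}\notin[d_j,d_i]$ if $r$ is incomparable with both $s$ and $t$. Bubble-sort $\mathrm{bbs}_{\mathsf S}=\mathrm{bbs}^m_{\mathsf S}\circ\dots\circ\mathrm{bbs}^1_{\mathsf S}$ is composed of the following stages. The stage $\mathrm{bbs}^k_{\mathsf S}$ repeats, as long as $d$ is not $\mathsf S[k]$-dominant (that is, as long as it is not true that $d_k=0$ if $k\notin v(\mathsf S)$, and $d_{v(s)}\ge d_k$ for all $s\succ v^{-1}(k)$ if $k\in v(\mathsf S)$), the replacement of $d$ by $(jk)d$, where $j$ is the largest value of $v$ on the set of $\preceq$-maximal elements of $\{s\in\mathsf S: v(s)<k,\ d_{v(s)}<d_k\}$. Then the following hold. 1. If $(ij)$ is a minimal $\mathsf S$-disorder of $a\in\mathsf D_{\mathsf S}$, then $(ij)a\in\mathsf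 D_{\mathsf S}$. For $a,b\in\mathsf D_{\mathsf S}$, $b$ covers $a$ in $\mathsf D_{\mathsf S}$ if and only if $b=(ij)a$ for some minimal $\mathsf S$-disorder $(ij)$ of $a$. 2. The poset $\mathsf D_{\mathsf S}$ is bounded (it has a least and a greatest element) and graded (all maximal chains between two given elements have the same length). Its rank function, that is, the length of the maximal chains from the least element to $d$, is $$\mathrm{rk}(d)=\#\{(s,t)\in\mathsf S^2:\ s\not\succ t,\ v(s)<v(t),\ d_{v(s)}<d_{v(t)}\}.$$ It is subthin (every open interval of length $2$ has at most two elements) and $\mathsf{EL}$-shellable: the edges of its Hasse diagram can be labelled by elements of some poset so that, for all $x<y$, exactly one maximal chain from $x$ to $y$ has strictly increasing labels, and its word of labels lexicographically precedes that of every other maximal chain from $x$ to $y$. 3. $\mathsf D_{\mathsf S}\subseteq\mathsf A_{\mathsf S}$, and $\mathsf A_{\mathsf S}=\mathbb S_m\lambda$ if $v$ is surjective. Bubble-sort restricts to a map $\mathsf A_{\mathsf S}\to\mathsf A_{\mathsf S}$ with image $\mathsf D_{\mathsf S}$ that is monotone, nonincreasing ($\mathrm{bbs}_{\mathsf S}(d)\preceq_{\mathrm{Br}}d$)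 and idempotent. In particular, if $v$ is surjective, it is a monotone nonincreasing idempotent $\mathrm{bbs}_{\mathsf S}:\mathbb S_m\lambda\twoheadrightarrow\mathsf D_{\mathsf S}$ (and $\mathbb S_m\lambda\simeq\mathbb S_m$). -/

import Mathlib

/-! Positions are indexed by `Fin m = {0, …, m - 1}` in place of `{1, …, m}`. -/

namespace Arborescent

/-! ### Posets -/

section Posets

/-- There are a least and a greatest element. -/
def IsBoundedPoset (X : Type*) [PartialOrder X] : Prop :=
  (∃ x : X, IsBot x) ∧ ∃ x : X, IsTop x

/-- `c` is a maximal (that is, saturated) chain from `x` to `y`, listed in increasing order with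
both end points; its length is `c.length - 1`. -/
structure IsMaximalChainBetween {X : Type*} [PartialOrder X] (x y : X) (c : List X) : Prop where
  head : c.head? = some x
  last : c.getLast? = some y
  chain : c.IsChain (fun a b => a ⋖ b)

/-- All maximal chains between two given elements have the same length. -/
def IsGradedPoset (X : Type*) [PartialOrder X] : Prop :=
  ∀ (x y : X) (c c' : List X), IsMaximalChainBetween x y c → IsMaximalChainBetween x y c' →
    c.length = c'.length

/-- `rk x` is the length of every maximal chain from the least element to `x`. -/
def IsRankFunction {X : Type*} [PartialOrder X] (rk : X → ℕ) : Prop :=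
  ∀ (x y : X) (c : List X), IsBot x → IsMaximalChainBetween x y c → c.length = rk y + 1

/-- A graded poset all of whose open intervals of length two have at most two elements. -/
def IsSubthin (X : Type*) [PartialOrder X] : Prop :=
  IsGradedPoset X ∧ ∀ (x y : X) (c : List X), IsMaximalChainBetween x y c → c.length = 3 →
    (Set.Ioo x y).encard ≤ 2

/-- The word of labels read along a list `x₀, x₁, …`, namely `E x₀ x₁, E x₁ x₂, …`. -/
def labelWord {X A : Type*} (E : X → X → A) (c : List X) : List A :=
  List.zipWith E c c.tail

/-- `E x y` is the label of the Hasse edge `x ⋖ y`; the values of `E` at other pairs are not used.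
Whenever `x < y` there is a unique maximal chain from `x` to `y` with strictly increasing labels,
and its word lexicographically precedes the word of every other maximal chain from `x` to `y`. -/
def IsELLabelling {X A : Type*} [PartialOrder X] [PartialOrder A] (E : X → X → A) : Prop :=
  ∀ x y : X, x < y → ∃ c : List X,
    IsMaximalChainBetween x y c ∧
    (labelWord E c).IsChain (fun a b => a < b) ∧
    (∀ c' : List X, IsMaximalChainBetween x y c' →
      (labelWord E c').IsChain (fun a b => a < b) → c' = c) ∧
    ∀ c' : List X, IsMaximalChainBetween x y c' → c' ≠ c →
      List.Lex (fun a b => a < b) (labelWord E c) (labelWord E c')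

/-- There is an EL-labelling with labels in some poset. -/
def IsELShellable (X : Type*) [PartialOrder X] : Prop :=
  ∃ (A : Type) (_ : PartialOrder A) (E : X → X → A), IsELLabelling E

end Posets

/-! ### Bruhat order on compositions -/

section Bruhat

variable {m : ℕ}

/-- `b` arises from `a` by exchanging entries `a i > a j` at positions `i < j`. -/
def BruhatStep (a b : Fin m → ℕ) : Prop :=
  ∃ i j : Fin m, i < j ∧ a j < a i ∧ b = a ∘ Equiv.swap i j

/-- The (strong) Bruhat order on compositions; the weakly decreasing ones are minimal. -/
def BruhatLE (a b : Fin m → ℕ) : Prop :=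
  Relation.ReflTransGen BruhatStep a b

theorem BruhatStep.weight_lt {a b : Fin m → ℕ} (h : BruhatStep a b) :
    ∑ l : Fin m, ((l : ℕ) : ℤ) * a l < ∑ l : Fin m, ((l : ℕ) : ℤ) * b l := by
  obtain ⟨i, j, hij, hd, rfl⟩ := h
  have hne : i ≠ j := hij.ne
  have key : ∑ l : Fin m, (((l : ℕ) : ℤ) * ((a ∘ Equiv.swap i j) l : ℕ) - ((l : ℕ) : ℤ) * a l)
      = (((j : ℕ) : ℤ) - (i : ℕ)) * ((a i : ℤ) - a j) := by
    rw [← Finset.sum_subset (Finset.subset_univ ({i, j} : Finset (Fin m)))]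
    · rw [Finset.sum_pair hne]
      simp only [Function.comp, Equiv.swap_apply_left, Equiv.swap_apply_right]
      ring
    · intro l _ hl
      simp only [Finset.mem_insert, Finset.mem_singleton, not_or] at hl
      simp [Function.comp, Equiv.swap_apply_of_ne_of_ne hl.1 hl.2]
  rw [Finset.sum_sub_distrib] at key
  have h1 : (0 : ℤ) < ((j : ℕ) : ℤ) - (i : ℕ) := by
    have : (i : ℕ) < j := hij
    omega
  have h2 : (0 : ℤ) < (a i : ℤ) - a j := by omega
  have := mul_pos h1 h2
  omega

theorem BruhatLE.weight_le {a b : Fin m → ℕ} (h : BruhatLE a b) :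
    a = b ∨ ∑ l : Fin m, ((l : ℕ) : ℤ) * a l < ∑ l : Fin m, ((l : ℕ) : ℤ) * b l := by
  induction h with
  | refl => exact Or.inl rfl
  | tail _ hs ih =>
    right
    rcases ih with rfl | ih
    · exact hs.weight_lt
    · exact ih.trans hs.weight_lt

/-- The orbit of `lam` under permutations of the positions. -/
@[ext] structure Orbit (lam : Fin m → ℕ) where
  val : Fin m → ℕ
  rearrangement : ∃ σ : Equiv.Perm (Fin m), val = lam ∘ σ

instance Orbit.instPartialOrder (lam : Fin m → ℕ) : PartialOrder (Orbit lam) where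
  le a b := BruhatLE a.val b.val
  le_refl _ := Relation.ReflTransGen.refl
  le_trans _ _ _ h h' := Relation.ReflTransGen.trans h h'
  le_antisymm a b h h' := by
    apply Orbit.ext
    rcases BruhatLE.weight_le h with e | h1
    · exact e
    · rcases BruhatLE.weight_le h' with e | h2
      · exact e.symm
      · exact absurd (h1.trans h2) (lt_irrefl _)

/-- `lam` is a partition with at most `n` parts, padded by zeros, whose first `n` entries are
pairwise distinct: `lam 0 > ⋯ > lam (n - 1) ≥ 0 = lam n = ⋯ = lam (m - 1)`. -/
structure IsRegularPartition (n : ℕ) (lam : Fin m → ℕ) : Prop where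
  strict : ∀ i j : Fin m, i < j → (j : ℕ) < n → lam j < lam i
  zero : ∀ i : Fin m, n ≤ (i : ℕ) → lam i = 0

end Bruhat

/-! ### Arborescent posets and dominant compositions -/

section Dominant

variable {S : Type*} [PartialOrder S] {m : ℕ}

/-- `(S, v)` is an arborescent poset with consistent anti-linearization. -/
structure IsConsistentAntiLinearization (v : S → Fin m) : Prop where
  injective : Function.Injective v
  strictAnti : StrictAnti v
  consistent : ∀ s t r : S, v s < v t → v t < v r → r < s → r < t

/-- `S[l]`-dominance of a composition. -/
def IsDominantAt (v : S → Fin m) (l : Fin m) (d : Fin m → ℕ) : Prop :=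
  (l ∉ Set.range v → d l = 0) ∧ ∀ t : S, v t = l → ∀ s : S, t < s → d l ≤ d (v s)

/-- `S`-dominance of a composition. -/
def IsDominant (v : S → Fin m) (d : Fin m → ℕ) : Prop :=
  (∀ l : Fin m, l ∉ Set.range v → d l = 0) ∧ ∀ s t : S, t < s → d (v t) ≤ d (v s)

/-- `S`-admissibility of a composition. -/
def IsAdmissible (v : S → Fin m) (d : Fin m → ℕ) : Prop :=
  ∀ k : Fin m, {j : Fin m | j ≤ k ∧ 0 < d j}.ncard ≤ {s : S | v s ≤ k}.ncard

/-- `S`-dominant compositions in the orbit of `lam`, with the induced Bruhat order. -/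
abbrev DominantPoset (v : S → Fin m) (lam : Fin m → ℕ) : Type :=
  {d : Orbit lam // IsDominant v d.val}

/-- `S`-admissible compositions in the orbit of `lam`, with the induced Bruhat order. -/
abbrev AdmissiblePoset (v : S → Fin m) (lam : Fin m → ℕ) : Type :=
  {d : Orbit lam // IsAdmissible v d.val}

/-- The positions `v s` and `v t` form a minimal `S`-disorder of `d`. -/
structure IsMinimalDisorder (v : S → Fin m) (d : Fin m → ℕ) (s t : S) : Prop where
  incomparable : ¬ s ≤ t ∧ ¬ t ≤ s
  position : v s < v t
  disorder : d (v t) < d (v s)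
  below : ∀ r : S, v s < v r → v r < v t → r < s → d (v r) ≤ d (v t)
  above : ∀ r : S, v s < v r → v r < v t → t < r → d (v s) ≤ d (v r)
  other : ∀ r : S, v s < v r → v r < v t → (¬ r ≤ s ∧ ¬ s ≤ r) → (¬ r ≤ t ∧ ¬ t ≤ r) →
    d (v r) ∉ Set.Icc (d (v t)) (d (v s))

/-- The number of pairs `(s, t)` with `s ⊁ t`, `v s < v t` and `d (v s) < d (v t)`. -/
noncomputable def disorderRank (v : S → Fin m) (d : Fin m → ℕ) : ℕ :=
  {p : S × S | ¬ p.2 < p.1 ∧ v p.1 < v p.2 ∧ d (v p.1) < d (v p.2)}.ncard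

/-! ### Bubble-sort -/

open Classical in
/-- The positions of the maximal elements of `{s | v s < k, d (v s) < d k}`. -/
noncomputable def swapCandidates (v : S → Fin m) (k : Fin m) (d : Fin m → ℕ) : Finset (Fin m) :=
  {j | ∃ s : S, v s = j ∧ Maximal (fun u => v u < k ∧ d (v u) < d k) s}

theorem lt_of_mem_swapCandidates {v : S → Fin m} {k : Fin m} {d : Fin m → ℕ} {j : Fin m}
    (h : j ∈ swapCandidates v k d) : d j < d k := by
  simp only [swapCandidates, Finset.mem_filter] at h
  obtain ⟨_, s, rfl, hs⟩ := h
  exact hs.1.2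

open Classical in
/-- The `k`-th stage: as long as `d` is not `S[k]`-dominant, exchange the entries at position `k`
and at the largest candidate position. (The stage also stops if there is no candidate; this does
not occur on admissible compositions that are dominant at all positions before `k`.) -/
noncomputable def bubbleStage (v : S → Fin m) (k : Fin m) (d : Fin m → ℕ) : Fin m → ℕ :=
  if h : ¬ IsDominantAt v k d ∧ (swapCandidates v k d).Nonempty then
    bubbleStage v k (d ∘ Equiv.swap ((swapCandidates v k d).max' h.2) k)
  else d
termination_by d k
decreasing_by
  simpa using lt_of_mem_swapCandidates (Finset.max'_mem _ h.2)

/-- Bubble-sort: all stages, performed for `k = 0, 1, …, m - 1` in this order. -/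
noncomputable def bubbleSort (v : S → Fin m) (d : Fin m → ℕ) : Fin m → ℕ :=
  (List.finRange m).foldl (fun e k => bubbleStage v k e) d

end Dominant

end Arborescent

/-! Restricting compositions to `S`, dominant compositions become injective monotone functions on
the forest `S`, whose elements are listed in postorder by `v`: the elements above `t` occupy an
interval of positions that ends at `t` (`IsPostorder.le_iff`). A minimal disorder is then an
exchange of two incomparable elements which is a covering relation of the full Bruhat order
(`isMinimalDisorder_iff`), so it adds exactly one inversion, and on dominant compositions the
number of inversions is `disorderRank`.

Everything else about the order comes from *greedy coatoms*. The Bruhat order implies the counting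
order `PrefixLE`. If `f` lies below `g` in the counting order and `f ≠ g`, let `s` be the first
position where they differ, and among the later positions with an entry in `(g s, f s]` let `t` be
the last in the right-to-left postorder of the forest (`IsGreedyPair`). Exchanging the entries of
`g` at `s` and `t` gives a dominant function which `g` covers and which still lies above `f`.
Consequently the counting order is the Bruhat order on dominant compositions (`le_of_prefixLE`),
the covering relations are the minimal disorders, and the poset is graded by inversions.

Label the exchange at `s`, `t` by `s`, in decreasing order, and then by the place of `t` in the
right-to-left postorder. On incomparable pairs this is the beginning of a reflection order of the
symmetric group in which comparable pairs come last. Greedy steps have increasing labels, and an increasing chain can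
only end in a greedy step (`IsGreedyPair.label_lt`, `IsGreedyPair.label_le_of_ne`), which gives
uniqueness of increasing chains. In an interval of length two, two chains correspond to two
factorizations of one permutation into transpositions, which share a transposition
(`swap_eq_or_eq_of_mul_eq`); hence a descent can be replaced by the greedy chain, whose first
label is smaller (`exists_smaller_label`), and the increasing chain is the lexicographically first
(`isELLabelling_of_greedy`). An interval with three middle elements would need all three
exchanges of three positions to be covering, which is impossible.

The decreasing composition is the least dominant one, and a maximal one must decrease along the
right-to-left postorder, which determines it. Finally, each step of bubble-sort moves down in the
Bruhat order but stays above every dominant composition below the initial one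
(`IsSelected.prefixLE`). So bubble-sort maps `d` to the greatest dominant composition below `d`,
which explains all its properties. -/

namespace Arborescent

/-! ### Prefix counts -/

section Count

variable {ι : Type*} {w : ι → ℕ} {f g h : ι → ℕ}

/-- The number of indices whose position lies in `[p, q)` and whose value is at least `c`. -/
noncomputable def blockCount (w f : ι → ℕ) (p q c : ℕ) : ℕ :=
  {r : ι | p ≤ w r ∧ w r < q ∧ c ≤ f r}.ncard

/-- The counting form of the Bruhat order: every initial segment of positions carries at least as
many values `≥ c` of `f` as of `g`. -/
def PrefixLE (w f g : ι → ℕ) : Prop :=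
  ∀ p c, blockCount w g 0 p c ≤ blockCount w f 0 p c

theorem PrefixLE.refl (w f : ι → ℕ) : PrefixLE w f f := fun _ _ => le_rfl

theorem PrefixLE.trans (h₁ : PrefixLE w f g) (h₂ : PrefixLE w g h) : PrefixLE w f h :=
  fun p c => (h₂ p c).trans (h₁ p c)

variable [Finite ι]

theorem blockCount_add (w f : ι → ℕ) {p q r : ℕ} (c : ℕ) (hpq : p ≤ q) (hqr : q ≤ r) :
    blockCount w f p r c = blockCount w f p q c + blockCount w f q r c := by
  unfold blockCount
  rw [← Set.ncard_union_eq]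
  · congr 1
    ext x
    simp only [Set.mem_ofPred_eq, Set.mem_union]
    omega
  · rw [Set.disjoint_left]
    intro x hx hx'
    simp only [Set.mem_ofPred_eq] at hx hx'
    omega

theorem blockCount_le {p q c c' : ℕ} (H : ∀ r, p ≤ w r → w r < q → c ≤ f r → c' ≤ g r) :
    blockCount w f p q c ≤ blockCount w g p q c' :=
  Set.ncard_le_ncard fun r hr => ⟨hr.1, hr.2.1, H r hr.1 hr.2.1 hr.2.2⟩

theorem blockCount_lt {p q c c' : ℕ} (H : ∀ r, p ≤ w r → w r < q → c ≤ f r → c' ≤ g r)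
    {x : ι} (hp : p ≤ w x) (hq : w x < q) (hg : c' ≤ g x) (hf : f x < c) :
    blockCount w f p q c < blockCount w g p q c' := by
  refine Set.ncard_lt_ncard ⟨fun r hr => ⟨hr.1, hr.2.1, H r hr.1 hr.2.1 hr.2.2⟩, fun hsub => ?_⟩
  have := (hsub (show x ∈ {r : ι | p ≤ w r ∧ w r < q ∧ c' ≤ g r} from ⟨hp, hq, hg⟩)).2.2
  omega

/-- At the first position where they may differ, the smaller function has the larger value. -/
theorem PrefixLE.le_of_agree (hw : Function.Injective w) (hfg : PrefixLE w f g) {a : ι}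
    (hag : ∀ r, w r < w a → f r = g r) : g a ≤ f a := by
  by_contra! hlt
  refine absurd (hfg (w a + 1) (g a)) (not_le.2 (blockCount_lt (x := a) ?_ ?_ ?_ ?_ hlt))
  · intro r _ hr hc
    rcases Nat.lt_or_ge (w r) (w a) with h | h
    · exact (hag r h) ▸ hc
    · rw [hw (by omega : w r = w a)]
  all_goals omega

variable [DecidableEq ι]

/-- Exchanging a disorder lowers exactly the prefix counts that separate the two positions and the
two values, by one each. -/
theorem blockCount_comp_swap {s t : ι} (hst : w s < w t)
    (hf : f t < f s) (p c : ℕ) :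
    blockCount w f 0 p c = blockCount w (f ∘ Equiv.swap s t) 0 p c +
      if w s < p ∧ p ≤ w t ∧ f t < c ∧ c ≤ f s then 1 else 0 := by
  have hne : s ≠ t := fun e => by rw [e] at hst; omega
  have swap_of_ne : ∀ x, x ≠ s → x ≠ t → Equiv.swap s t x = x :=
    fun x => Equiv.swap_apply_of_ne_of_ne
  by_cases hsep : w s < p ∧ p ≤ w t ∧ f t < c ∧ c ≤ f s
  · rw [if_pos hsep]
    unfold blockCount
    rw [← Set.ncard_insert_of_notMem (a := s)]
    · congr 1
      ext x
      by_cases hxs : x = s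
      · subst hxs; simp; omega
      by_cases hxt : x = t
      · subst hxt; simp [hxs]; omega
      simp [hxs, swap_of_ne x hxs hxt]
    · simp; omega
  · rw [if_neg hsep, add_zero]
    unfold blockCount
    by_cases hc : f t < c ∧ c ≤ f s
    · -- both positions lie on the same side of `p`
      by_cases hp : w t < p
      · refine Set.ncard_congr (fun x _ => Equiv.swap s t x) ?_ ?_ ?_
        · intro x hx
          by_cases hxs : x = s
          · subst hxs; simp_all
          by_cases hxt : x = t
          · subst hxt; simp_all; omega
          simpa [swap_of_ne x hxs hxt] using hx
        · intro x y _ _ hxy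
          exact (Equiv.swap s t).injective hxy
        · intro x hx
          refine ⟨Equiv.swap s t x, ?_, by simp⟩
          by_cases hxs : x = s
          · subst hxs; simp_all
          by_cases hxt : x = t
          · subst hxt; simp_all; omega
          simpa [swap_of_ne x hxs hxt] using hx
      · congr 1
        ext x
        by_cases hxs : x = s
        · subst hxs; simp; omega
        by_cases hxt : x = t
        · subst hxt; simp; omega
        simp [swap_of_ne x hxs hxt]
    · congr 1
      ext x
      by_cases hxs : x = s
      · subst hxs; simp; omega
      by_cases hxt : x = t
      · subst hxt; simp; omega
      simp [swap_of_ne x hxs hxt]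

theorem prefixLE_comp_swap {s t : ι} (hst : w s < w t)
    (hf : f t < f s) : PrefixLE w f (f ∘ Equiv.swap s t) := by
  intro p c
  rw [blockCount_comp_swap hst hf]
  exact Nat.le_add_right _ _

end Count

/-! ### Postorders of forests -/

section Postorder

variable {S : Type*} [PartialOrder S]

/-- Positions in `ℕ` whose order is a postorder traversal of the forest `S`. -/
structure IsPostorder (w : S → ℕ) : Prop where
  injective : Function.Injective w
  strictAnti : StrictAnti w
  consistent : ∀ s t r : S, w s < w t → w t < w r → r < s → r < t

/-- The smallest position of an element above `t`. -/
noncomputable def firstPos (w : S → ℕ) (t : S) : ℕ :=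
  sInf (w '' Set.Ici t)

variable {w : S → ℕ}

theorem firstPos_le {t s : S} (h : t ≤ s) : firstPos w t ≤ w s :=
  Nat.sInf_le ⟨s, h, rfl⟩

/-- The elements above `t` are exactly those in an interval of positions that ends at `t`. -/
theorem IsPostorder.le_iff (hw : IsPostorder w) {t s : S} :
    t ≤ s ↔ firstPos w t ≤ w s ∧ w s ≤ w t := by
  refine ⟨fun h => ⟨firstPos_le h, hw.strictAnti.antitone h⟩, fun ⟨h1, h2⟩ => ?_⟩
  obtain ⟨s₀, hs₀, e⟩ : firstPos w t ∈ w '' Set.Ici t :=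
    Nat.sInf_mem ⟨w t, t, Set.self_mem_Ici, rfl⟩
  have hs₀ : t ≤ s₀ := hs₀
  rw [← e] at h1
  rcases h1.eq_or_lt with h1 | h1
  · exact hw.injective h1 ▸ hs₀
  rcases h2.eq_or_lt with h2 | h2
  · exact (hw.injective h2).ge
  · exact (hw.consistent s₀ s t h1 h2 (lt_of_le_of_ne hs₀ fun e => by rw [e] at h2; omega)).le

/-- A key that increases along the right-to-left postorder of the forest: an element comes after
those above it, and of two incomparable elements the one at the later position comes first. -/
noncomputable def key (w : S → ℕ) (t : S) : ℕᵒᵈ ×ₗ ℕ :=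
  toLex (OrderDual.toDual (firstPos w t), w t)

theorem key_le_iff {r t : S} :
    key w r ≤ key w t ↔ firstPos w t < firstPos w r ∨ firstPos w t = firstPos w r ∧ w r ≤ w t := by
  simp [key, Prod.Lex.le_iff, eq_comm]

theorem key_injective (hw : IsPostorder w) : Function.Injective (key w) := by
  intro r t h
  have h1 := key_le_iff.1 h.le
  have h2 := key_le_iff.1 h.ge
  exact hw.injective (by omega)

theorem le_of_key_le (hw : IsPostorder w) {r t : S} (h : key w r ≤ key w t) (hrt : w r < w t) :
    t ≤ r := by
  have h1 := key_le_iff.1 h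
  have h2 := firstPos_le (w := w) (le_refl r)
  exact hw.le_iff.2 (by omega)

theorem firstPos_anti {r t : S} (h : r ≤ t) : firstPos w r ≤ firstPos w t := by
  obtain ⟨s₀, hs₀, e⟩ : firstPos w t ∈ w '' Set.Ici t :=
    Nat.sInf_mem ⟨w t, t, Set.self_mem_Ici, rfl⟩
  exact e ▸ firstPos_le (h.trans hs₀)

theorem key_lt_of_lt (hw : IsPostorder w) {r t : S} (h : r < t) : key w t < key w r := by
  refine lt_of_not_ge fun hle => ?_
  have h1 := key_le_iff.1 hle
  have h2 := firstPos_anti (w := w) h.le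
  have h3 := hw.strictAnti h
  omega

/-- The label of the exchange of the entries at `s` and `t`, where `s` has the smaller position. -/
noncomputable def label (w : S → ℕ) (s t : S) : ℕᵒᵈ ×ₗ (ℕᵒᵈ ×ₗ ℕ) :=
  toLex (OrderDual.toDual (w s), key w t)

theorem label_lt_iff {s t s' t' : S} :
    label w s t < label w s' t' ↔ w s' < w s ∨ w s' = w s ∧ key w t < key w t' := by
  simp [label, Prod.Lex.lt_iff, eq_comm]

theorem label_le_iff {s t s' t' : S} :
    label w s t ≤ label w s' t' ↔ w s' < w s ∨ w s' = w s ∧ key w t ≤ key w t' := by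
  simp [label, Prod.Lex.le_iff, eq_comm]

theorem label_injective (hw : IsPostorder w) {s t s' t' : S} (h : label w s t = label w s' t') :
    s = s' ∧ t = t' := by
  have h1 := label_le_iff.1 h.le
  have h2 := label_le_iff.1 h.ge
  have h3 : w s = w s' := by omega
  refine ⟨hw.injective h3, key_injective hw (le_antisymm ?_ ?_)⟩
  · exact (h1.resolve_left (by omega)).2
  · exact (h2.resolve_left (by omega)).2

end Postorder

/-! ### Covering exchanges and inversions -/

section Covering

theorem swap_eq_swap_of_position {ι : Type*} [DecidableEq ι] {w : ι → ℕ} {s t s' t' : ι}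
    (h : w s < w t) (h' : w s' < w t')
    (e : Equiv.swap s t = Equiv.swap s' t') : s = s' ∧ t = t' := by
  have hne : s ≠ t := fun e => by rw [e] at h; omega
  have h1 : Equiv.swap s' t' s = t := by rw [← e, Equiv.swap_apply_left]
  by_cases hs : s = s'
  · subst hs
    exact ⟨rfl, by simpa using h1.symm⟩
  by_cases hs' : s = t'
  · subst hs'
    rw [Equiv.swap_apply_right] at h1
    subst h1
    omega
  · rw [Equiv.swap_apply_of_ne_of_ne hs hs'] at h1
    exact absurd h1 hne

variable {S : Type*} [PartialOrder S] {w f g k : S → ℕ} {s t : S}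

/-- The positions `s`, `t` are incomparable and exchanging their entries is a covering relation of
the Bruhat order. For monotone injective `f` this restates `IsMinimalDisorder`. -/
structure IsCoveringPair (w f : S → ℕ) (s t : S) : Prop where
  position : w s < w t
  disorder : f t < f s
  not_lt : ¬ t < s
  between : ∀ r, w s < w r → w r < w t → f r < f t ∨ f s < f r

theorem IsCoveringPair.ne (h : IsCoveringPair w f s t) : s ≠ t := fun e => by
  have := h.position
  rw [e] at this
  omega

/-- The number of inversions of `f`, with respect to the decreasing arrangement. -/
noncomputable def inversions (w f : S → ℕ) : ℕ :=
  {p : S × S | w p.1 < w p.2 ∧ f p.1 < f p.2}.ncard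

variable [DecidableEq S]

/-- Exchanging a covering pair keeps `f` monotone: the elements whose entries could be affected
are, by consistency, positioned between `s` and `t`. -/
theorem IsCoveringPair.monotone_comp_swap (hw : IsPostorder w) (hf : Monotone f)
    (h : IsCoveringPair w f s t) : Monotone (f ∘ Equiv.swap s t) := by
  have hne : s ≠ t := fun e => by have := h.position; rw [e] at this; omega
  have hd := h.disorder
  intro r u hru
  rcases hru.eq_or_lt with rfl | hlt
  · exact le_rfl
  have hpos := hw.strictAnti hlt
  have hru' := hf hru
  simp only [Function.comp]
  by_cases hrs : r = s
  · subst hrs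
    have hut : u ≠ t := fun e => by subst e; have := h.position; omega
    rw [Equiv.swap_apply_left, Equiv.swap_apply_of_ne_of_ne hlt.ne' hut]
    omega
  by_cases hrt : r = t
  · subst hrt
    have hus : u ≠ s := fun e => h.not_lt (e ▸ hlt)
    rw [Equiv.swap_apply_right, Equiv.swap_apply_of_ne_of_ne hus hlt.ne']
    by_cases hsu : w s < w u
    · have := h.between u hsu hpos
      omega
    · have : w u ≠ w s := fun e => hus (hw.injective e)
      exact absurd (hw.consistent u s r (by omega) h.position hlt) h.not_lt
  rw [Equiv.swap_apply_of_ne_of_ne hrs hrt]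
  by_cases hus : u = s
  · subst hus
    rw [Equiv.swap_apply_left]
    by_cases hrt' : w r < w t
    · have := h.between r hpos hrt'
      omega
    · have : w r ≠ w t := fun e => hrt (hw.injective e)
      exact hf (hw.consistent u t r h.position (by omega) hlt).le
  by_cases hut : u = t
  · subst hut
    rw [Equiv.swap_apply_right]
    omega
  rwa [Equiv.swap_apply_of_ne_of_ne hus hut]

/-- Exchanging a covering pair increases the number of inversions by exactly one: the other pairs
are matched by applying the exchange to both members whenever this keeps them in order. -/
theorem IsCoveringPair.inversions_comp_swap [Finite S] (hw : Function.Injective w)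
    (h : IsCoveringPair w f s t) :
    inversions w (f ∘ Equiv.swap s t) = inversions w f + 1 := by
  have hd := h.disorder
  have hp := h.position
  have hne : s ≠ t := fun e => by rw [e] at hp; omega
  set σ := Equiv.swap s t with hσ
  have hσσ : ∀ x, σ (σ x) = x := fun x => Equiv.swap_apply_self s t x
  let ψ : S × S → S × S := fun p => if w (σ p.1) < w (σ p.2) then (σ p.1, σ p.2) else p
  have hψψ : ∀ p : S × S, w p.1 < w p.2 → ψ (ψ p) = p := by
    intro p hp
    by_cases hc : w (σ p.1) < w (σ p.2)
    · simp [ψ, hc, hσσ, hp]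
    · simp [ψ, hc]
  have hord : ∀ p : S × S, w p.1 < w p.2 → w (ψ p).1 < w (ψ p).2 := by
    intro p hp
    by_cases hc : w (σ p.1) < w (σ p.2)
    · simp [ψ, hc]
    · simp [ψ, hc, hp]
  have hst : ψ (s, t) = (s, t) := by
    have : ¬ w t < w s := by omega
    simp [ψ, hσ, this]
  have hval : ∀ p : S × S, w p.1 < w p.2 → p ≠ (s, t) →
      (f p.1 < f p.2 ↔ (f ∘ σ) (ψ p).1 < (f ∘ σ) (ψ p).2) := by
    rintro ⟨x, y⟩ hxy hne'
    by_cases hc : w (σ x) < w (σ y)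
    · simp [ψ, hc, hσσ]
    simp only [ψ, hc, if_false, Function.comp]
    simp only at hxy
    by_cases hxs : x = s
    · subst hxs
      have hyt : y ≠ t := fun e => hne' (by rw [e])
      have hyx : y ≠ x := fun e => by rw [e] at hxy; omega
      have hwy : w y ≠ w t := fun e => hyt (hw e)
      rw [hσ, Equiv.swap_apply_left, Equiv.swap_apply_of_ne_of_ne hyx hyt] at hc ⊢
      have := h.between y hxy (by omega)
      omega
    by_cases hxt : x = t
    · subst hxt
      have hys : y ≠ s := fun e => by rw [e] at hxy; omega
      have hyx : y ≠ x := fun e => by rw [e] at hxy; omega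
      rw [hσ, Equiv.swap_apply_right, Equiv.swap_apply_of_ne_of_ne hys hyx] at hc
      omega
    rw [hσ, Equiv.swap_apply_of_ne_of_ne hxs hxt] at hc ⊢
    by_cases hys : y = s
    · subst hys
      rw [Equiv.swap_apply_left] at hc
      omega
    by_cases hyt : y = t
    · subst hyt
      have hwx : w x ≠ w s := fun e => hxs (hw e)
      rw [Equiv.swap_apply_right] at hc ⊢
      have := h.between x (by omega) hxy
      omega
    rw [Equiv.swap_apply_of_ne_of_ne hys hyt]
  have hnot : (s, t) ∉ {p : S × S | w p.1 < w p.2 ∧ f p.1 < f p.2} := fun H => by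
    have := H.2
    simp only at this
    omega
  have himage : {p : S × S | w p.1 < w p.2 ∧ (f ∘ σ) p.1 < (f ∘ σ) p.2} =
      insert (s, t) (ψ '' {p : S × S | w p.1 < w p.2 ∧ f p.1 < f p.2}) := by
    ext p
    simp only [Set.mem_ofPred_eq, Set.mem_insert_iff, Set.mem_image]
    constructor
    · rintro ⟨h1, h2⟩
      by_cases hpst : p = (s, t)
      · exact Or.inl hpst
      refine Or.inr ⟨ψ p, ⟨hord p h1, ?_⟩, hψψ p h1⟩
      have hne' : ψ p ≠ (s, t) := fun e => hpst (by rw [← hψψ p h1, e, hst])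
      rwa [hval _ (hord p h1) hne', hψψ p h1]
    · rintro (rfl | ⟨q, ⟨h1, h2⟩, rfl⟩)
      · refine ⟨hp, ?_⟩
        simpa [hσ] using hd
      · refine ⟨hord q h1, (hval q h1 ?_).1 h2⟩
        rintro rfl
        exact hnot ⟨h1, h2⟩
  unfold inversions
  rw [himage, Set.ncard_insert_of_notMem, Set.InjOn.ncard_image]
  · intro p hp' q hq' e
    rw [← hψψ p hp'.1, ← hψψ q hq'.1, e]
  · rintro ⟨q, hq, e⟩
    have : q = (s, t) := by rw [← hψψ q hq.1, e, hst]
    exact hnot (this ▸ hq)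

end Covering

/-! ### Greedy coatoms -/

section Greedy

variable {S : Type*} [PartialOrder S] {w f g k : S → ℕ} {s t a b s' t' s₁ t₁ : S}

/-- The exchange that leads from `g` to the greedy coatom of the interval from `f` to `g`: `s` is
the first position where `f` and `g` differ, and `t` has the largest key among the later positions
whose entry may be moved to `s` without passing below `f`. -/
structure IsGreedyPair (w f g : S → ℕ) (s t : S) : Prop where
  agree : ∀ r, w r < w s → f r = g r
  lt : g s < f s
  position : w s < w t
  lt' : g s < g t
  le : g t ≤ f s
  key_le : ∀ r, w s < w r → g s < g r → g r ≤ f s → key w r ≤ key w t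

theorem exists_isGreedyPair [Finite S] (hw : IsPostorder w) (hf : Function.Injective f)
    (hfg : PrefixLE w f g) (hne : f ≠ g) (hrange : ∀ r, 0 < f r → ∃ u, g u = f r) :
    ∃ s t, IsGreedyPair w f g s t := by
  obtain ⟨r, hr⟩ := Function.ne_iff.1 hne
  obtain ⟨s, hs, hmin⟩ := Set.exists_min_image {r | f r ≠ g r} w (Set.toFinite _) ⟨r, hr⟩
  have hagree : ∀ r, w r < w s → f r = g r := by
    intro r hrs
    by_contra hne
    exact absurd (hmin r hne) (by omega)
  have hlt : g s < f s := lt_of_le_of_ne (hfg.le_of_agree hw.injective hagree) (Ne.symm hs)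
  obtain ⟨u, hu⟩ := hrange s (by omega)
  have hus : w s < w u := by
    by_contra! hle
    rcases hle.eq_or_lt with e | h
    · rw [hw.injective e] at hu
      omega
    · have := hf ((hagree u h).trans hu)
      rw [this] at h
      omega
  obtain ⟨t, ⟨h1, h2, h3⟩, hmax⟩ :=
    Set.exists_max_image {r | w s < w r ∧ g s < g r ∧ g r ≤ f s} (key w) (Set.toFinite _)
      ⟨u, hus, by omega, by omega⟩
  exact ⟨s, t, hagree, hlt, h1, h2, h3, fun r hr1 hr2 hr3 => hmax r ⟨hr1, hr2, hr3⟩⟩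

/-- Entries between the two greedy positions that compete with the chosen one lie above `t`. -/
theorem IsGreedyPair.le_of_between (hw : IsPostorder w) (h : IsGreedyPair w f g s t) {r : S}
    (hs : w s < w r) (ht : w r < w t) (hr : g s < g r) (hr' : g r ≤ f s) : t ≤ r :=
  le_of_key_le hw (h.key_le r hs hr hr') ht

variable [DecidableEq S]

theorem IsGreedyPair.isCoveringPair (hw : IsPostorder w) (hg : Monotone g)
    (hinj : Function.Injective g) (h : IsGreedyPair w f g s t) :
    IsCoveringPair w (g ∘ Equiv.swap s t) s t := by
  have h1 := h.lt'
  have h2 := h.le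
  refine ⟨h.position, by simpa using h1, fun hlt => absurd (hg hlt.le) (by omega), ?_⟩
  intro r hsr hrt
  have hrs : r ≠ s := fun e => by rw [e] at hsr; omega
  have hrt' : r ≠ t := fun e => by rw [e] at hrt; omega
  simp only [Function.comp, Equiv.swap_apply_left, Equiv.swap_apply_right,
    Equiv.swap_apply_of_ne_of_ne hrs hrt']
  by_contra! hcon
  have h3 : g r ≠ g s := fun e => hrs (hinj e)
  have h4 : g r ≠ g t := fun e => hrt' (hinj e)
  have := hg (h.le_of_between hw hsr hrt (by omega) (by omega))
  omega

theorem IsGreedyPair.monotone_comp_swap (hw : IsPostorder w) (hf : Monotone f) (hg : Monotone g)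
    (h : IsGreedyPair w f g s t) : Monotone (g ∘ Equiv.swap s t) := by
  have h1 := h.lt'
  have h2 := h.le
  have hp := h.position
  intro r u hru
  rcases hru.eq_or_lt with rfl | hlt
  · exact le_rfl
  have hpos := hw.strictAnti hlt
  have hru' := hg hru
  simp only [Function.comp]
  by_cases hrs : r = s
  · subst hrs
    have hut : u ≠ t := fun e => by subst e; omega
    rw [Equiv.swap_apply_left, Equiv.swap_apply_of_ne_of_ne hlt.ne' hut, ← h.agree u hpos]
    exact h2.trans (hf hru)
  by_cases hrt : r = t
  · subst hrt
    have hus : u ≠ s := fun e => by subst e; omega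
    rw [Equiv.swap_apply_right, Equiv.swap_apply_of_ne_of_ne hus hlt.ne']
    omega
  rw [Equiv.swap_apply_of_ne_of_ne hrs hrt]
  by_cases hus : u = s
  · subst hus
    rw [Equiv.swap_apply_left]
    omega
  by_cases hut : u = t
  · subst hut
    rw [Equiv.swap_apply_right]
    by_contra! hlt'
    exact absurd (h.key_le r (by omega) hlt' (by omega)) (not_le.2 (key_lt_of_lt hw hlt))
  rwa [Equiv.swap_apply_of_ne_of_ne hus hut]

/-- The greedy exchange does not leave the interval. Prefixes that end before the elements above
`t` are compared through the threshold `f s + 1`; longer ones through the interval of positions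
occupied by the elements above `t`. -/
theorem IsGreedyPair.prefixLE_comp_swap [Finite S] (hw : IsPostorder w) (hf : Monotone f)
    (hg : Monotone g) (hfg : PrefixLE w f g) (h : IsGreedyPair w f g s t) :
    PrefixLE w f (g ∘ Equiv.swap s t) := by
  have h1 := h.lt'
  have h2 := h.le
  have hp := h.position
  have hcount := fun p c => blockCount_comp_swap (f := g ∘ Equiv.swap s t) hp
    (by simpa using h1) p c
  simp only [Function.comp_assoc, ← Equiv.coe_trans, Equiv.swap_swap,
    Equiv.coe_refl, Function.comp_id, Function.comp_apply, Equiv.swap_apply_left,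
    Equiv.swap_apply_right] at hcount
  intro p c
  rw [hcount]
  split_ifs with hsep
  swap
  · exact hfg p c
  obtain ⟨hsp, hpt, hsc, hct⟩ := hsep
  rw [Nat.add_one_le_iff]
  -- prefixes that contain no competitor of `t` after `s`
  have hA : ∀ q, w s < q → (∀ r, w s < w r → w r < q → c ≤ g r → f s < g r) →
      blockCount w g 0 q c < blockCount w f 0 q c := by
    intro q hq hno
    have e1 := blockCount_add w f c (Nat.zero_le (w s)) hq.le
    have e2 := blockCount_add w g c (Nat.zero_le (w s)) hq.le
    have e3 := blockCount_add w f (f s + 1) (Nat.zero_le (w s)) hq.le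
    have e4 := blockCount_add w g (f s + 1) (Nat.zero_le (w s)) hq.le
    have i1 := hfg q (f s + 1)
    have i2 : ∀ c, blockCount w f 0 (w s) c = blockCount w g 0 (w s) c := fun c =>
      le_antisymm (blockCount_le fun r _ hr hc => h.agree r hr ▸ hc)
        (blockCount_le fun r _ hr hc => (h.agree r hr).symm ▸ hc)
    have i3 : blockCount w g (w s) q c ≤ blockCount w g (w s) q (f s + 1) := by
      refine blockCount_le fun r hr hrq hc => ?_
      rcases hr.eq_or_lt with e | hr
      · rw [← hw.injective e] at hc
        omega
      · exact hno r hr hrq hc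
    have i4 : blockCount w f (w s) q (f s + 1) < blockCount w f (w s) q c :=
      blockCount_lt (fun r _ _ hc => by omega) (x := s) le_rfl hq (by omega) (by omega)
    have := i2 c
    have := i2 (f s + 1)
    omega
  by_cases hcomp : ∃ r, w s < w r ∧ w r < p ∧ c ≤ g r ∧ g r ≤ f s
  swap
  · push Not at hcomp
    exact hA p hsp hcomp
  obtain ⟨l, hsl, hlp, hcl, hls⟩ := hcomp
  have htl := h.le_of_between hw hsl (by omega) (by omega) hls
  set L := firstPos w t with hL
  have hLl : L ≤ w l := firstPos_le htl
  have hts : ¬ t ≤ s := fun hle => absurd (hg hle) (by omega)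
  have hsL : w s < L := by
    by_contra! hle
    exact hts (hw.le_iff.2 ⟨hle, hp.le⟩)
  have hAL := hA L hsL fun r hsr hrL hc => by
    by_contra! hle
    have := firstPos_le (w := w) (h.le_of_between hw hsr (by
      have := (hw.le_iff.1 htl).2
      omega) (by omega) hle)
    omega
  have hgabove : ∀ r, L ≤ w r → w r ≤ w t → c ≤ g r := fun r hr hr' =>
    hct.trans (hg (hw.le_iff.2 ⟨hr, hr'⟩))
  by_cases hlow : ∃ r, L ≤ w r ∧ w r < p ∧ f r < c
  · obtain ⟨r, hLr, hrp, hrc⟩ := hlow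
    have hft : f t < c := (hf (hw.le_iff.2 ⟨hLr, by omega⟩)).trans_lt hrc
    have e1 := blockCount_add w f c (Nat.zero_le p) (show p ≤ w t + 1 by omega)
    have e2 := blockCount_add w g c (Nat.zero_le p) (show p ≤ w t + 1 by omega)
    have i1 := hfg (w t + 1) c
    have i2 : blockCount w f p (w t + 1) c < blockCount w g p (w t + 1) c :=
      blockCount_lt (fun r hr hr' _ => hgabove r (by omega) (by omega)) (x := t) hpt (by omega)
        hct hft
    omega
  · push Not at hlow
    have e1 := blockCount_add w f c (Nat.zero_le L) (show L ≤ p by omega)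
    have e2 := blockCount_add w g c (Nat.zero_le L) (show L ≤ p by omega)
    have i1 : blockCount w g L p c ≤ blockCount w f L p c :=
      blockCount_le fun r hr hr' _ => hlow r hr hr'
    omega

end Greedy

/-! ### Labels along greedy coatoms -/

section Labels

variable {S : Type*} [PartialOrder S] [DecidableEq S] {w f g k : S → ℕ} {s t a b s₁ t₁ : S}

/-- Labels increase along two successive greedy exchanges. -/
theorem IsGreedyPair.label_lt (hw : IsPostorder w) (h : IsGreedyPair w f g s t)
    (h₁ : IsGreedyPair w f (g ∘ Equiv.swap s t) s₁ t₁) : label w s₁ t₁ < label w s t := by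
  have a1 := h.lt
  have a2 := h.position
  have b1 := h₁.lt
  have b2 := h₁.lt'
  have b3 := h₁.le
  have b4 := h₁.position
  have hne : ∀ r, w r < w s → Equiv.swap s t r = r := fun r hr =>
    Equiv.swap_apply_of_ne_of_ne (fun e => by rw [e] at hr; omega) fun e => by rw [e] at hr; omega
  rw [label_lt_iff]
  rcases Nat.lt_trichotomy (w s) (w s₁) with hlt | heq | hlt
  · exact Or.inl hlt
  · have := hw.injective heq
    subst this
    refine Or.inr ⟨rfl, ?_⟩
    simp only [Function.comp, Equiv.swap_apply_left] at b1 b2 b3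
    have c0 := h.lt'
    have hs : t₁ ≠ s := fun e => by rw [e] at b4; omega
    have ht : t₁ ≠ t := fun e => by rw [e, Equiv.swap_apply_right] at b2; omega
    rw [Equiv.swap_apply_of_ne_of_ne hs ht] at b2 b3
    exact lt_of_le_of_ne (h.key_le t₁ b4 (by omega) b3) fun e => ht (key_injective hw e)
  · have := h.agree s₁ hlt
    simp only [Function.comp, hne s₁ hlt] at b1
    omega

/-- If the covering exchange of `a`, `b` leads from `k`, still above `f`, to `g`, but is not the
greedy one for `f` and `g`, then the label of the greedy exchange below `k` is not smaller than its
own. So an increasing chain that ends greedily at `k` cannot be continued by this exchange. -/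
theorem IsGreedyPair.label_le_of_ne [Finite S] (hw : IsPostorder w) (hk : Monotone k)
    (hkinj : Function.Injective k) (hfk : PrefixLE w f k) (hab : IsCoveringPair w k a b)
    (h : IsGreedyPair w f (k ∘ Equiv.swap a b) s t) (hne : ¬ (a = s ∧ b = t))
    (h₁ : IsGreedyPair w f k s₁ t₁) : label w a b ≤ label w s₁ t₁ := by
  have hpos := hab.position
  have hdis := hab.disorder
  have hswap : ∀ r, w r < w a → Equiv.swap a b r = r := fun r hr =>
    Equiv.swap_apply_of_ne_of_ne (fun e => by rw [e] at hr; omega) fun e => by rw [e] at hr; omega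
  -- the first position moved by the exchange is not before the first difference
  have hsa : w s ≤ w a := by
    by_contra! hlt
    have e := h.agree a hlt
    have := hfk.le_of_agree hw.injective (a := a) fun r hr => by
      rw [h.agree r (by omega)]
      simp [hswap r hr]
    simp only [Function.comp, Equiv.swap_apply_left] at e
    omega
  have hagree : ∀ r, w r < w s → f r = k r := fun r hr => by
    rw [h.agree r hr]
    simp [hswap r (by omega)]
  have hss₁ : w s ≤ w s₁ := by
    by_contra! hlt
    have := hagree s₁ hlt
    have := h₁.lt
    omega
  have hs₁ : k s ≠ f s → s₁ = s := fun hd => by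
    by_contra hne
    have : w s₁ ≠ w s := fun e => hne (hw.injective e)
    exact hd (h₁.agree s (by omega)).symm
  rw [label_le_iff]
  have hlt := h.lt
  have hlt' := h.lt'
  have hle := h.le
  have hst := h.position
  rcases hsa.eq_or_lt with heq | hsa
  swap
  · simp only [Function.comp, hswap s hsa] at hlt
    rw [hs₁ hlt.ne]
    exact Or.inl hsa
  have := hw.injective heq
  subst this
  simp only [Function.comp, Equiv.swap_apply_left] at hlt hlt' hle
  have hks : k s ≤ f s := hfk.le_of_agree hw.injective hagree
  have hbt : b ≠ t := fun e => hne ⟨rfl, e⟩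
  have hts : t ≠ s := fun e => by rw [e] at hst; omega
  rw [Equiv.swap_apply_of_ne_of_ne hts hbt.symm] at hlt' hle
  have hkey : key w b < key w t := by
    refine lt_of_le_of_ne (h.key_le b hpos ?_ ?_) fun e => hbt (key_injective hw e)
    · simpa using hdis
    · simpa using hks
  have hkt : k s < k t := by
    by_contra! hcon
    have : k t ≠ k s := fun e => hts (hkinj e)
    rcases Nat.lt_or_ge (w t) (w b) with htb | hbt'
    · have := hab.between t hst htb
      omega
    · have : w b ≠ w t := fun e => hbt (hw.injective e)
      have := hk (le_of_key_le hw hkey.le (by omega))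
      omega
  have hss := hs₁ (by omega)
  subst hss
  exact Or.inr ⟨rfl, hkey.le.trans (h₁.key_le t hst hkt hle)⟩

end Labels

/-! ### Maximal chains and labellings -/

section Chains

variable {X A : Type*} [PartialOrder X] {x y z : X} {c : List X}

theorem isMaximalChainBetween_singleton (x : X) : IsMaximalChainBetween x x [x] :=
  ⟨rfl, rfl, List.isChain_singleton x⟩

theorem IsMaximalChainBetween.cons (hxz : x ⋖ z) (h : IsMaximalChainBetween z y c) :
    IsMaximalChainBetween x y (x :: c) := by
  obtain ⟨h1, h2, h3⟩ := h
  cases c with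
  | nil => simp at h1
  | cons b c =>
    simp only [List.head?_cons, Option.some.injEq] at h1
    subst h1
    exact ⟨rfl, by simpa using h2, List.isChain_cons_cons.2 ⟨hxz, h3⟩⟩

theorem IsMaximalChainBetween.cases_cons (h : IsMaximalChainBetween x y c) :
    (c = [x] ∧ x = y) ∨ ∃ z c', c = x :: c' ∧ x ⋖ z ∧ IsMaximalChainBetween z y c' := by
  obtain ⟨h1, h2, h3⟩ := h
  match c with
  | [] => simp at h1
  | [a] =>
    simp only [List.head?_cons, Option.some.injEq] at h1
    simp only [List.getLast?_singleton, Option.some.injEq] at h2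
    exact Or.inl ⟨by rw [h1], h1 ▸ h2⟩
  | a :: b :: c' =>
    simp only [List.head?_cons, Option.some.injEq] at h1
    subst h1
    rw [List.isChain_cons_cons] at h3
    exact Or.inr ⟨b, b :: c', rfl, h3.1, rfl, by simpa using h2, h3.2⟩

theorem IsMaximalChainBetween.cases_snoc (h : IsMaximalChainBetween x y c) :
    (c = [x] ∧ x = y) ∨ ∃ z c', c = c' ++ [y] ∧ z ⋖ y ∧ IsMaximalChainBetween x z c' := by
  obtain ⟨h1, h2, h3⟩ := h
  rcases List.eq_nil_or_concat c with rfl | ⟨c', b, rfl⟩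
  · simp at h1
  simp only [List.concat_eq_append, List.getLast?_append, List.getLast?_singleton,
    Option.some_or, Option.some.injEq] at h2 h1 h3 ⊢
  subst h2
  rcases List.eq_nil_or_concat c' with rfl | ⟨c'', z, rfl⟩
  · simp only [List.nil_append, List.head?_cons, Option.some.injEq] at h1
    subst h1
    exact Or.inl ⟨rfl, rfl⟩
  · simp only [List.concat_eq_append] at h1 h3 ⊢
    rw [List.isChain_append] at h3
    refine Or.inr ⟨z, _, rfl, h3.2.2 z (by simp) b (by simp), ?_, by simp, h3.1⟩
    rw [← h1]
    cases c'' <;> simp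

theorem IsMaximalChainBetween.length_add {rk : X → ℕ} (hrk : ∀ x y, x ⋖ y → rk y = rk x + 1)
    (h : IsMaximalChainBetween x y c) : c.length + rk x = rk y + 1 := by
  induction c generalizing x with
  | nil => exact absurd h.head (by simp)
  | cons a c ih =>
    rcases h.cases_cons with ⟨e, rfl⟩ | ⟨z, c', e, hxz, hc'⟩
    · rw [e]
      simp [add_comm]
    · obtain ⟨rfl, rfl⟩ := List.cons.inj e
      have := ih hc'
      have := hrk _ _ hxz
      simp only [List.length_cons]
      omega

theorem IsMaximalChainBetween.le (h : IsMaximalChainBetween x y c) : x ≤ y := by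
  induction c generalizing x with
  | nil => exact absurd h.head (by simp)
  | cons a c ih =>
    rcases h.cases_cons with ⟨-, rfl⟩ | ⟨z, c', e, hxz, hc'⟩
    · exact le_rfl
    · obtain ⟨rfl, rfl⟩ := List.cons.inj e
      exact hxz.le.trans (ih hc')

theorem IsMaximalChainBetween.labelWord_cons (E : X → X → A) (h : IsMaximalChainBetween z y c) :
    labelWord E (x :: c) = E x z :: labelWord E c := by
  have h1 := h.head
  cases c with
  | nil => simp at h1
  | cons b c =>
    simp only [List.head?_cons, Option.some.injEq] at h1
    subst h1
    rfl

theorem IsMaximalChainBetween.labelWord_snoc (E : X → X → A) (h : IsMaximalChainBetween x z c) :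
    labelWord E (c ++ [y]) = labelWord E c ++ [E z y] := by
  induction c generalizing x with
  | nil => exact absurd h.head (by simp)
  | cons a c ih =>
    rcases h.cases_cons with ⟨e, rfl⟩ | ⟨u, c', e, hxu, hc'⟩
    · rw [e]
      rfl
    · obtain ⟨rfl, rfl⟩ := List.cons.inj e
      have h1 := hc'.head
      cases c with
      | nil => simp at h1
      | cons b c =>
        have := ih hc'
        simp only [labelWord, List.cons_append, List.tail_cons, List.zipWith_cons_cons,
          List.cons.injEq, true_and] at this ⊢
        exact this

variable [LinearOrder A] {E : X → X → A} {G : X → X → X → Prop}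

/-- In an increasing chain the last step is greedy, by induction: otherwise the chain up to its
coatom would end greedily, with a label that is not smaller than the last one. -/
theorem last_eq_of_increasing [Finite X] (hG : ∀ x y, x < y → ∃ z, G x y z)
    (hGc : ∀ x y z, G x y z → x ≤ z ∧ z ⋖ y)
    (hlast : ∀ x y z z' u, G x y z → x ≤ z' → z' ⋖ y → z' ≠ z → G x z' u → E z' y ≤ E u z')
    {z₀ : X} (hc : IsMaximalChainBetween x z c) (hzy : z ⋖ y)
    (hinc : (labelWord E (c ++ [y])).IsChain (fun a b => a < b)) (h₀ : G x y z₀) : z = z₀ := by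
  induction z using WellFoundedLT.induction generalizing c y z₀ with
  | ind z ih =>
    by_contra hne
    rcases hc.cases_snoc with ⟨-, rfl⟩ | ⟨u, c', rfl, huz, hc'⟩
    · obtain ⟨h1, h2⟩ := hGc _ _ _ h₀
      exact hzy.2 (lt_of_le_of_ne h1 hne) h2.lt
    · have hxz : x < z := hc'.le.trans_lt huz.lt
      obtain ⟨t, ht⟩ := hG x z hxz
      rw [hc.labelWord_snoc, List.isChain_append] at hinc
      have hu := ih u huz.lt hc' huz hinc.1 ht
      rw [← hu] at ht
      have hlt := hinc.2.2 (E u z) (by rw [hc'.labelWord_snoc]; simp) (E z y) (by simp)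
      exact absurd (hlast x y z₀ z u h₀ hxz.le hzy hne ht) (not_le.2 hlt)

theorem eq_of_increasing [Finite X] (hG : ∀ x y, x < y → ∃ z, G x y z)
    (hGc : ∀ x y z, G x y z → x ≤ z ∧ z ⋖ y)
    (hlast : ∀ x y z z' u, G x y z → x ≤ z' → z' ⋖ y → z' ≠ z → G x z' u → E z' y ≤ E u z')
    {c' : List X} (hc : IsMaximalChainBetween x y c)
    (hinc : (labelWord E c).IsChain (fun a b => a < b)) (hc' : IsMaximalChainBetween x y c')
    (hinc' : (labelWord E c').IsChain (fun a b => a < b)) : c = c' := by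
  induction y using WellFoundedLT.induction generalizing c c' with
  | ind y ih =>
    rcases hc.cases_snoc with ⟨rfl, rfl⟩ | ⟨u, d, rfl, hu, hd⟩ <;>
      rcases hc'.cases_snoc with ⟨rfl, e⟩ | ⟨u', d', rfl, hu', hd'⟩
    · rfl
    · exact absurd (hd'.le.trans_lt hu'.lt) (lt_irrefl _)
    · subst e
      exact absurd (hd.le.trans_lt hu.lt) (lt_irrefl _)
    · obtain ⟨z₀, h₀⟩ := hG x y (hd.le.trans_lt hu.lt)
      have e := last_eq_of_increasing hG hGc hlast hd hu hinc h₀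
      have e' := last_eq_of_increasing hG hGc hlast hd' hu' hinc' h₀
      obtain rfl : u = u' := e.trans e'.symm
      rw [hd.labelWord_snoc, List.isChain_append] at hinc
      rw [hd'.labelWord_snoc, List.isChain_append] at hinc'
      rw [ih u hu.lt hd hinc.1 hd' hinc'.1]

/-- An edge labelling is an EL-labelling if descents can be exchanged for a smaller first label,
and if coatoms `G x y` can be singled out that are the last steps of increasing chains. -/
theorem isELLabelling_of_greedy [Finite X] (hG : ∀ x y, x < y → ∃ z, G x y z)
    (hGc : ∀ x y z, G x y z → x ≤ z ∧ z ⋖ y)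
    (hlast : ∀ x y z z' u, G x y z → x ≤ z' → z' ⋖ y → z' ≠ z → G x z' u → E z' y ≤ E u z')
    (hexch : ∀ x z y, x ⋖ z → z ⋖ y → ¬ E x z < E z y →
      ∃ z', x ⋖ z' ∧ z' ⋖ y ∧ E x z' < E x z) : IsELLabelling E := by
  -- a step with the least label among the atoms below `y` extends increasing chains
  have hcons : ∀ x y u c, x ⋖ u → (∀ a, x ⋖ a → a ≤ y → E x u ≤ E x a) →
      IsMaximalChainBetween u y c → (labelWord E c).IsChain (fun a b => a < b) →
      (labelWord E (x :: c)).IsChain (fun a b => a < b) := by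
    intro x y u c hxu hmin hc hinc
    rw [hc.labelWord_cons]
    rcases hc.cases_cons with ⟨rfl, -⟩ | ⟨z, d, rfl, huz, hd⟩
    · exact List.isChain_singleton _
    · rw [hd.labelWord_cons] at hinc ⊢
      refine List.isChain_cons_cons.2 ⟨?_, hinc⟩
      by_contra hnot
      obtain ⟨z', h1, h2, h3⟩ := hexch x u z hxu huz hnot
      exact absurd (hmin z' h1 (h2.le.trans hd.le)) (not_le.2 h3)
  have key : ∀ y x, x ≤ y → ∃ c, IsMaximalChainBetween x y c ∧
      (labelWord E c).IsChain (fun a b => a < b) ∧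
      ∀ c', IsMaximalChainBetween x y c' → c' ≠ c →
        List.Lex (fun a b => a < b) (labelWord E c) (labelWord E c') := by
    intro y x
    induction x using WellFoundedGT.induction with
    | ind x ih =>
      intro hxy
      rcases hxy.eq_or_lt with rfl | hlt
      · refine ⟨[x], isMaximalChainBetween_singleton x, List.isChain_nil, fun c' hc' hne => ?_⟩
        rcases hc'.cases_cons with ⟨rfl, -⟩ | ⟨z, d, rfl, hxz, hd⟩
        · exact absurd rfl hne
        · exact absurd (hxz.lt.trans_le hd.le) (lt_irrefl _)
      obtain ⟨a, ha, hay⟩ := exists_covBy_le_of_lt hlt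
      obtain ⟨u, ⟨hxu, huy⟩, hmin⟩ :=
        Set.exists_min_image {a | x ⋖ a ∧ a ≤ y} (E x) (Set.toFinite _) ⟨a, ha, hay⟩
      have hmin : ∀ a, x ⋖ a → a ≤ y → E x u ≤ E x a := fun a h h' => hmin a ⟨h, h'⟩
      obtain ⟨c, hc, hinc, hlex⟩ := ih u hxu.lt huy
      have hxc := hcons x y u c hxu hmin hc hinc
      refine ⟨x :: c, hc.cons hxu, hxc, fun c' hc' hne => ?_⟩
      rcases hc'.cases_cons with ⟨-, rfl⟩ | ⟨z, d, rfl, hxz, hd⟩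
      · exact absurd hlt (lt_irrefl _)
      rw [hc.labelWord_cons, hd.labelWord_cons]
      by_cases hzu : z = u
      · subst hzu
        exact List.Lex.cons (hlex d hd fun e => hne (by rw [e]))
      · refine List.Lex.rel (lt_of_not_ge fun hle => hzu ?_)
        obtain ⟨c₂, hc₂, hinc₂, -⟩ := ih z hxz.lt hd.le
        have hxc₂ := hcons x y z c₂ hxz (fun a h h' => hle.trans (hmin a h h')) hc₂ hinc₂
        have e := eq_of_increasing hG hGc hlast (hc₂.cons hxz) hxc₂ (hc.cons hxu) hxc
        have e := (List.cons.inj e).2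
        have h1 := hc₂.head
        rw [e, hc.head] at h1
        exact (Option.some.inj h1).symm
  intro x y hxy
  obtain ⟨c, hc, hinc, hlex⟩ := key y x hxy.le
  exact ⟨c, hc, hinc, fun c' hc' hinc' => eq_of_increasing hG hGc hlast hc' hinc' hc hinc, hlex⟩

end Chains

/-! ### Products of two transpositions -/

section Swaps

open Equiv

variable {α : Type*} [DecidableEq α] {a b c d x y z w : α}

/-- The first factor of a product of two disjoint transpositions is one of the two. -/
theorem swap_eq_of_mul_eq_of_disjoint
    (hab : a ≠ b) (hac : a ≠ c) (had : a ≠ d) (hbc : b ≠ c) (hbd : b ≠ d) (hcd : c ≠ d)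
    (hxy : x ≠ y) (e : swap a b * swap c d = swap x y * swap z w)
    (hne : swap x y ≠ swap a b) : swap x y = swap c d := by
  have h1 := Equiv.congr_fun e a
  have h2 := Equiv.congr_fun e b
  have h3 := Equiv.congr_fun e c
  have h4 := Equiv.congr_fun e d
  simp only [Perm.mul_apply, swap_apply_def, hab, hac, had, hbc, hbd, hcd, hab.symm, hac.symm,
    had.symm, hbc.symm, hbd.symm, hcd.symm, if_true, if_false] at h1 h2 h3 h4
  have h5 : ¬ (x = a ∧ y = b) := by rintro ⟨rfl, rfl⟩; exact hne rfl
  have h6 : ¬ (x = b ∧ y = a) := by rintro ⟨rfl, rfl⟩; exact hne (swap_comm _ _)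
  have : (x = c ∧ y = d) ∨ (x = d ∧ y = c) := by
    clear e hne
    grind (splits := 40)
  rcases this with ⟨rfl, rfl⟩ | ⟨rfl, rfl⟩
  · rfl
  · exact swap_comm _ _

/-- The factorizations of a three-cycle into two transpositions are cyclically related. -/
theorem swap_eq_of_mul_eq_of_chain (hab : a ≠ b) (hac : a ≠ c) (hbc : b ≠ c)
    (hxy : x ≠ y) (e : swap a b * swap b c = swap x y * swap z w)
    (hne : swap x y ≠ swap a b) :
    swap x y = swap b c ∨ swap x y = swap a c ∧ swap z w = swap a b := by
  have h1 := Equiv.congr_fun e a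
  have h2 := Equiv.congr_fun e b
  have h3 := Equiv.congr_fun e c
  simp only [Perm.mul_apply, swap_apply_def, hab, hac, hbc, hab.symm, hac.symm, hbc.symm,
    if_true, if_false] at h1 h2 h3
  have h5 : ¬ (x = a ∧ y = b) := by rintro ⟨rfl, rfl⟩; exact hne rfl
  have h6 : ¬ (x = b ∧ y = a) := by rintro ⟨rfl, rfl⟩; exact hne (swap_comm _ _)
  have : (x = b ∧ y = c) ∨ (x = c ∧ y = b) ∨
      (x = a ∧ y = c ∨ x = c ∧ y = a) ∧ (z = a ∧ w = b ∨ z = b ∧ w = a) := by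
    clear e hne
    grind (splits := 40)
  rcases this with ⟨rfl, rfl⟩ | ⟨rfl, rfl⟩ | ⟨⟨rfl, rfl⟩ | ⟨rfl, rfl⟩, ⟨rfl, rfl⟩ | ⟨rfl, rfl⟩⟩ <;>
    simp [swap_comm]

theorem swap_disjoint_or_chain (hab : a ≠ b) (hcd : c ≠ d) (hne : swap a b ≠ swap c d) :
    (a ≠ c ∧ a ≠ d ∧ b ≠ c ∧ b ≠ d) ∨ ∃ α β γ, α ≠ β ∧ α ≠ γ ∧ β ≠ γ ∧
      swap a b = swap α β ∧ swap c d = swap β γ := by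
  by_cases hac : a = c
  · subst hac
    exact Or.inr ⟨b, a, d, hab.symm, fun e => hne (by rw [e]), hcd, swap_comm _ _, rfl⟩
  by_cases had : a = d
  · subst had
    exact Or.inr ⟨b, a, c, hab.symm, fun e => hne (by rw [e, swap_comm]), hcd.symm, swap_comm _ _,
      swap_comm _ _⟩
  by_cases hbc : b = c
  · subst hbc
    exact Or.inr ⟨a, b, d, hab, had, hcd, rfl, rfl⟩
  by_cases hbd : b = d
  · subst hbd
    exact Or.inr ⟨a, b, c, hab, hac, hcd.symm, rfl, swap_comm _ _⟩
  exact Or.inl ⟨hac, had, hbc, hbd⟩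

/-- Two different factorizations of a product of two transpositions share a transposition, which
is the second factor of one and the first factor of the other. -/
theorem swap_eq_or_eq_of_mul_eq (hab : a ≠ b) (hcd : c ≠ d) (hxy : x ≠ y)
    (h : swap a b ≠ swap c d) (e : swap a b * swap c d = swap x y * swap z w)
    (hne : swap x y ≠ swap a b) : swap x y = swap c d ∨ swap z w = swap a b := by
  rcases swap_disjoint_or_chain hab hcd h with ⟨h1, h2, h3, h4⟩ | ⟨α, β, γ, h1, h2, h3, e1, e2⟩
  · exact Or.inl (swap_eq_of_mul_eq_of_disjoint hab h1 h2 h3 h4 hcd hxy e hne)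
  · rw [e1, e2] at e
    rw [e1] at hne
    rw [e1, e2]
    exact (swap_eq_of_mul_eq_of_chain h1 h2 h3 hxy e hne).imp_right And.right

/-- A product of two transpositions with three different factorizations is a three-cycle. -/
theorem exists_of_three_factorizations {p q p₂ q₂ p₃ q₃ : α × α}
    (hp : p.1 ≠ p.2) (hq : q.1 ≠ q.2) (hp₂ : p₂.1 ≠ p₂.2) (hp₃ : p₃.1 ≠ p₃.2)
    (h : swap p.1 p.2 ≠ swap q.1 q.2)
    (e₂ : swap p.1 p.2 * swap q.1 q.2 = swap p₂.1 p₂.2 * swap q₂.1 q₂.2)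
    (e₃ : swap p.1 p.2 * swap q.1 q.2 = swap p₃.1 p₃.2 * swap q₃.1 q₃.2)
    (h₂ : swap p₂.1 p₂.2 ≠ swap p.1 p.2) (h₃ : swap p₃.1 p₃.2 ≠ swap p.1 p.2)
    (h₂₃ : swap p₂.1 p₂.2 ≠ swap p₃.1 p₃.2) :
    ∃ α β γ, α ≠ β ∧ α ≠ γ ∧ β ≠ γ ∧
      ∀ r ∈ [swap α β, swap α γ, swap β γ],
        r ∈ [swap p.1 p.2, swap p₂.1 p₂.2, swap p₃.1 p₃.2] := by
  rcases swap_disjoint_or_chain hp hq h with ⟨h1, h2, h3, h4⟩ | ⟨α, β, γ, h1, h2, h3, e1, e2⟩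
  · exact absurd ((swap_eq_of_mul_eq_of_disjoint hp h1 h2 h3 h4 hq hp₂ e₂ h₂).trans
      (swap_eq_of_mul_eq_of_disjoint hp h1 h2 h3 h4 hq hp₃ e₃ h₃).symm) h₂₃
  · refine ⟨α, β, γ, h1, h2, h3, ?_⟩
    rw [e1, e2] at e₂ e₃
    rw [e1] at h₂ h₃ ⊢
    have f₂ := swap_eq_of_mul_eq_of_chain h1 h2 h3 hp₂ e₂ h₂
    have f₃ := swap_eq_of_mul_eq_of_chain h1 h2 h3 hp₃ e₃ h₃
    rcases f₂ with f₂ | ⟨f₂, -⟩ <;> rcases f₃ with f₃ | ⟨f₃, -⟩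
    · exact absurd (f₂.trans f₃.symm) h₂₃
    · simp [f₂, f₃]
    · simp [f₂, f₃]
    · exact absurd (f₂.trans f₃.symm) h₂₃

end Swaps

/-! ### Dominant compositions as monotone functions on the forest -/

section Entries

variable {S : Type*} [PartialOrder S] {m : ℕ} {v : S → Fin m} {lam d e : Fin m → ℕ}

/-- The position of an index, as a natural number. -/
def pos {ι : Type*} (v : ι → Fin m) (s : ι) : ℕ := v s

/-- A dominant composition, viewed as a function on `S`. -/
def entries (x : DominantPoset v lam) : S → ℕ := x.val.val ∘ v

theorem IsConsistentAntiLinearization.isPostorder (hv : IsConsistentAntiLinearization v) :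
    IsPostorder (pos v) where
  injective := Fin.val_injective.comp hv.injective
  strictAnti := hv.strictAnti
  consistent := hv.consistent

theorem entries_monotone (x : DominantPoset v lam) : Monotone (entries x) := by
  intro t s h
  rcases h.eq_or_lt with rfl | h
  · exact le_rfl
  · exact x.property.2 s t h

theorem eq_of_entries_eq {x y : DominantPoset v lam} (h : entries x = entries y) : x = y := by
  apply Subtype.ext
  apply Orbit.ext
  funext l
  by_cases hl : l ∈ Set.range v
  · obtain ⟨s, rfl⟩ := hl
    exact congrFun h s
  · rw [x.property.1 l hl, y.property.1 l hl]

theorem exists_entries_eq (x y : DominantPoset v lam) {s : S} (h : 0 < entries x s) :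
    ∃ u, entries y u = entries x s := by
  obtain ⟨σ, hσ⟩ := x.val.rearrangement
  obtain ⟨τ, hτ⟩ := y.val.rearrangement
  have hval : y.val.val (τ.symm (σ (v s))) = entries x s := by
    simp [entries, hσ, hτ]
  by_cases hl : τ.symm (σ (v s)) ∈ Set.range v
  · obtain ⟨u, hu⟩ := hl
    exact ⟨u, by rw [← hval, ← hu]; rfl⟩
  · rw [y.property.1 _ hl] at hval
    omega

theorem ncard_le_val (x : Orbit lam) (c : ℕ) :
    {l | c ≤ x.val l}.ncard = {l | c ≤ lam l}.ncard := by
  obtain ⟨σ, hσ⟩ := x.rearrangement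
  refine Set.ncard_congr (fun l _ => σ l) ?_ ?_ ?_
  · intro l hl
    simpa [hσ] using hl
  · intro l l' _ _ h
    exact σ.injective h
  · intro l hl
    exact ⟨σ.symm l, by simpa [hσ] using hl, by simp⟩

/-- The entries outside `v(S)` vanish and do not contribute to counts with a positive threshold. -/
theorem blockCount_comp_eq {ι : Type*} {v : ι → Fin m} (hv : Function.Injective v)
    (hd : ∀ l, l ∉ Set.range v → d l = 0) {p q c : ℕ} (hc : 0 < c) :
    blockCount Fin.val d p q c = blockCount (pos v) (d ∘ v) p q c := by
  unfold blockCount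
  rw [← Set.ncard_image_of_injective _ hv]
  congr 1
  ext l
  constructor
  · rintro ⟨h1, h2, h3⟩
    by_cases hl : l ∈ Set.range v
    · obtain ⟨s, rfl⟩ := hl
      exact ⟨s, ⟨h1, h2, h3⟩, rfl⟩
    · rw [hd l hl] at h3
      omega
  · rintro ⟨s, hs, rfl⟩
    exact hs

theorem prefixLE_entries_iff (hv : Function.Injective v) {x y : DominantPoset v lam} :
    PrefixLE (pos v) (entries x) (entries y) ↔ PrefixLE Fin.val x.val.val y.val.val := by
  have h1 := fun p c => blockCount_comp_eq (p := 0) (q := p) (c := c) hv x.property.1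
  have h2 := fun p c => blockCount_comp_eq (p := 0) (q := p) (c := c) hv y.property.1
  constructor <;> intro h p c <;> rcases Nat.eq_zero_or_pos c with rfl | hc
  · simp [blockCount]
  · rw [h1 p c hc, h2 p c hc]
    exact h p c
  · simp [blockCount]
  · have := h p c
    rwa [h1 p c hc, h2 p c hc] at this

theorem BruhatStep.prefixLE (h : BruhatStep d e) : PrefixLE Fin.val d e := by
  obtain ⟨i, j, hij, hd, rfl⟩ := h
  exact prefixLE_comp_swap hij hd

theorem BruhatLE.prefixLE (h : BruhatLE d e) : PrefixLE Fin.val d e := by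
  induction h with
  | refl => exact PrefixLE.refl _ _
  | tail _ hs ih => exact ih.trans hs.prefixLE

theorem prefixLE_of_le (hv : Function.Injective v) {x y : DominantPoset v lam} (h : x ≤ y) :
    PrefixLE (pos v) (entries x) (entries y) :=
  (prefixLE_entries_iff hv).2 (BruhatLE.prefixLE h)

theorem entries_injective [Finite S] (hv : Function.Injective v)
    (hlam : IsRegularPartition (Nat.card S) lam) (x : DominantPoset v lam) :
    Function.Injective (entries x) := by
  obtain ⟨σ, hσ⟩ := x.val.rearrangement
  have hn : Nat.card S ≤ m := by simpa using Nat.card_le_card_of_injective v hv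
  intro s t hst
  by_contra hne
  have hσne : σ (v s) ≠ σ (v t) := fun e => hne (hv (σ.injective e))
  have hst' : lam (σ (v s)) = lam (σ (v t)) := by simpa [entries, hσ] using hst
  have hzero : lam (σ (v s)) = 0 := by
    by_contra hpos
    have h1 : (σ (v s) : ℕ) < Nat.card S := by
      by_contra! h
      exact hpos (hlam.zero _ h)
    have h2 : (σ (v t) : ℕ) < Nat.card S := by
      by_contra! h
      exact hpos (hst'.trans (hlam.zero _ h))
    rcases lt_or_gt_of_ne hσne with h | h
    · have := hlam.strict _ _ h h2
      omega
    · have := hlam.strict _ _ h h1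
      omega
  -- all but at most one of the first `n` entries of `lam` are positive, which is too many
  -- for the positions of the elements other than `s` and `t`
  have hsub : Set.range (fun a : Fin (Nat.card S - 1) => σ.symm ⟨a, by omega⟩) ⊆
      v '' ({s, t} : Set S)ᶜ := by
    rintro _ ⟨a, rfl⟩
    have ha := a.isLt
    have hlt : 0 < lam ⟨a, by omega⟩ :=
      (Nat.zero_le _).trans_lt (hlam.strict ⟨a, by omega⟩ ⟨a + 1, by omega⟩
        (by simp [Fin.lt_def]) (by simp only; omega))
    have hval : x.val.val (σ.symm ⟨a, by omega⟩) = lam ⟨a, by omega⟩ := by simp [hσ]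
    by_cases hl : σ.symm ⟨a, by omega⟩ ∈ Set.range v
    · obtain ⟨u, hu⟩ := hl
      refine ⟨u, ?_, hu⟩
      rw [← hu, hσ] at hval
      simp only [Function.comp] at hval
      rintro (rfl | rfl) <;> omega
    · rw [x.property.1 _ hl] at hval
      omega
  have h1 := Set.ncard_le_ncard hsub
  rw [Set.ncard_image_of_injective _ hv, Set.ncard_compl, Set.ncard_pair hne,
    ← Set.image_univ, Set.ncard_image_of_injective _
      (fun a b h => Fin.ext (by simpa using h)), Set.ncard_univ, Nat.card_fin] at h1
  have h2 := Set.ncard_le_card ({s, t} : Set S)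
  rw [Set.ncard_pair hne] at h2
  omega

theorem isMinimalDisorder_iff [Finite S]
    (hv : IsConsistentAntiLinearization v)
    (hlam : IsRegularPartition (Nat.card S) lam) (x : DominantPoset v lam) {s t : S} :
    IsMinimalDisorder v x.val.val s t ↔ IsCoveringPair (pos v) (entries x) s t := by
  have hmono := entries_monotone x
  have hinj := entries_injective hv.injective hlam x
  constructor
  · intro h
    refine ⟨h.position, h.disorder, fun hlt => h.incomparable.2 hlt.le, fun r hsr hrt => ?_⟩
    have hrs : entries x r ≠ entries x s := fun e => by
      rw [hinj e] at hsr
      exact lt_irrefl _ hsr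
    have hrt' : entries x r ≠ entries x t := fun e => by
      rw [hinj e] at hrt
      exact lt_irrefl _ hrt
    have hsr' : ¬ s ≤ r := fun hle => absurd (hv.strictAnti.antitone hle) (not_le.2 hsr)
    have hrt'' : ¬ r ≤ t := fun hle => absurd (hv.strictAnti.antitone hle) (not_le.2 hrt)
    by_cases h1 : r ≤ s
    · have : entries x r ≤ entries x t :=
        h.below r hsr hrt (lt_of_le_of_ne h1 fun e => hrs (by rw [e]))
      omega
    by_cases h2 : t ≤ r
    · have : entries x s ≤ entries x r :=
        h.above r hsr hrt (lt_of_le_of_ne h2 fun e => hrt' (by rw [e]))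
      omega
    have := h.other r hsr hrt ⟨h1, hsr'⟩ ⟨hrt'', h2⟩
    by_contra! hcon
    exact this ⟨hcon.1, hcon.2⟩
  · intro h
    have hne : s ≠ t := fun e => by
      have := h.position
      rw [e] at this
      omega
    refine ⟨⟨fun hle => absurd (hv.strictAnti.antitone hle) (not_le.2 h.position), fun hle =>
      h.not_lt (lt_of_le_of_ne hle hne.symm)⟩, h.position, h.disorder, ?_, ?_, ?_⟩
    · intro r h1 h2 h3
      have := h.between r h1 h2
      have := hmono h3.le
      simp only [entries, Function.comp] at *
      omega
    · intro r h1 h2 h3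
      have := h.between r h1 h2
      have := hmono h3.le
      simp only [entries, Function.comp] at *
      omega
    · intro r h1 h2 _ _ ⟨h3, h4⟩
      have := h.between r h1 h2
      simp only [entries, Function.comp] at *
      omega

theorem disorderRank_eq (x : DominantPoset v lam) :
    disorderRank v x.val.val = inversions (pos v) (entries x) := by
  unfold disorderRank inversions
  congr 1
  ext p
  refine ⟨fun h => h.2, fun h => ⟨fun hlt => ?_, h⟩⟩
  exact absurd (entries_monotone x hlt.le) (not_le.2 h.2)

theorem perm_eq_of_comp_eq [Finite S] (hv : IsConsistentAntiLinearization v)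
    (hlam : IsRegularPartition (Nat.card S) lam) {x : DominantPoset v lam} {σ τ : Equiv.Perm S}
    (h : entries x ∘ σ = entries x ∘ τ) : σ = τ :=
  Equiv.ext fun r => entries_injective hv.injective hlam x (congrFun h r)

end Entries

section DominantOrder

theorem eq_comp_swap {ι : Type*} [DecidableEq ι] {s t : ι} {f g : ι → ℕ}
    (h : f = g ∘ Equiv.swap s t) : g = f ∘ Equiv.swap s t := by
  rw [h, Function.comp_assoc, ← Equiv.coe_trans, Equiv.swap_swap]
  rfl

theorem comp_swap_comp {ι : Type*} [DecidableEq ι] {m : ℕ} {v : ι → Fin m}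
    (hv : Function.Injective v) (d : Fin m → ℕ) (s t : ι) :
    (d ∘ Equiv.swap (v s) (v t)) ∘ v = (d ∘ v) ∘ Equiv.swap s t := by
  funext r
  simp [hv.swap_apply]

variable {S : Type*} [PartialOrder S] [DecidableEq S] {m : ℕ} {v : S → Fin m}
  {lam d : Fin m → ℕ} {x y z : DominantPoset v lam} {s t : S}

theorem isDominant_comp_swap (hv : Function.Injective v) (x : DominantPoset v lam)
    (h : Monotone (entries x ∘ Equiv.swap s t)) :
    IsDominant v (x.val.val ∘ Equiv.swap (v s) (v t)) := by
  refine ⟨fun l hl => ?_, fun a b hab => ?_⟩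
  · have h1 : l ≠ v s := fun e => hl ⟨s, e.symm⟩
    have h2 : l ≠ v t := fun e => hl ⟨t, e.symm⟩
    simp [Equiv.swap_apply_of_ne_of_ne h1 h2, x.property.1 l hl]
  · have := h hab.le
    rw [entries, ← comp_swap_comp hv] at this
    exact this

theorem exists_comp_swap (hv : Function.Injective v) (x : DominantPoset v lam)
    (h : Monotone (entries x ∘ Equiv.swap s t)) :
    ∃ y : DominantPoset v lam, entries y = entries x ∘ Equiv.swap s t := by
  obtain ⟨σ, hσ⟩ := x.val.rearrangement
  exact ⟨⟨⟨x.val.val ∘ Equiv.swap (v s) (v t), Equiv.swap (v s) (v t) |>.trans σ, by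
    rw [hσ]; rfl⟩, isDominant_comp_swap hv x h⟩, comp_swap_comp hv _ s t⟩

theorem val_eq_comp_swap_iff (hv : Function.Injective v) :
    y.val.val = x.val.val ∘ Equiv.swap (v s) (v t) ↔
      entries y = entries x ∘ Equiv.swap s t := by
  rw [entries, entries, ← comp_swap_comp hv]
  refine ⟨fun h => by rw [h], fun h => ?_⟩
  funext l
  by_cases hl : l ∈ Set.range v
  · obtain ⟨r, rfl⟩ := hl
    exact congrFun h r
  · have h1 : l ≠ v s := fun e => hl ⟨s, e.symm⟩
    have h2 : l ≠ v t := fun e => hl ⟨t, e.symm⟩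
    simp [Equiv.swap_apply_of_ne_of_ne h1 h2, x.property.1 l hl, y.property.1 l hl]

theorem lt_of_entries_eq (hv : Function.Injective v) (h : IsCoveringPair (pos v) (entries x) s t)
    (e : entries y = entries x ∘ Equiv.swap s t) : x < y := by
  refine lt_of_le_of_ne (Relation.ReflTransGen.single
    ⟨v s, v t, h.position, h.disorder, (val_eq_comp_swap_iff hv).2 e⟩) ?_
  rintro rfl
  have h1 := congrFun e s
  have h2 := h.disorder
  simp only [Function.comp, Equiv.swap_apply_left] at h1
  omega

variable [Finite S]

/-- The greedy coatom of an interval, among dominant compositions. -/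
theorem exists_greedy (hv : IsConsistentAntiLinearization v)
    (hlam : IsRegularPartition (Nat.card S) lam)
    (h : PrefixLE (pos v) (entries x) (entries y)) (hne : x ≠ y) :
    ∃ (z : DominantPoset v lam) (s t : S), IsGreedyPair (pos v) (entries x) (entries y) s t ∧
      entries z = entries y ∘ Equiv.swap s t ∧ PrefixLE (pos v) (entries x) (entries z) := by
  have hw := hv.isPostorder
  obtain ⟨s, t, hst⟩ := exists_isGreedyPair hw (entries_injective hv.injective hlam x) h
    (fun e => hne (eq_of_entries_eq e)) fun r hr => exists_entries_eq x y hr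
  obtain ⟨z, hz⟩ := exists_comp_swap hv.injective y
    (hst.monotone_comp_swap hw (entries_monotone x) (entries_monotone y))
  exact ⟨z, s, t, hst, hz,
    hz ▸ hst.prefixLE_comp_swap hw (entries_monotone x) (entries_monotone y) h⟩

theorem IsGreedyPair.isCoveringPair_of_eq (hv : IsConsistentAntiLinearization v)
    (hlam : IsRegularPartition (Nat.card S) lam)
    (h : IsGreedyPair (pos v) (entries x) (entries y) s t)
    (e : entries z = entries y ∘ Equiv.swap s t) : IsCoveringPair (pos v) (entries z) s t :=
  e ▸ h.isCoveringPair hv.isPostorder (entries_monotone y) (entries_injective hv.injective hlam y)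

theorem inversions_eq (hv : IsConsistentAntiLinearization v)
    (h : IsCoveringPair (pos v) (entries x) s t) (e : entries y = entries x ∘ Equiv.swap s t) :
    inversions (pos v) (entries y) = inversions (pos v) (entries x) + 1 := by
  rw [e, h.inversions_comp_swap hv.isPostorder.injective]

/-- Between dominant compositions the counting criterion characterizes the Bruhat order. -/
theorem le_of_prefixLE (hv : IsConsistentAntiLinearization v)
    (hlam : IsRegularPartition (Nat.card S) lam)
    (h : PrefixLE (pos v) (entries x) (entries y)) : x ≤ y := by
  induction hk : inversions (pos v) (entries y) generalizing y with
  | zero =>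
    by_contra hle
    obtain ⟨z, s, t, hst, e, hz⟩ := exists_greedy hv hlam h fun e => hle (e ▸ le_rfl)
    have := inversions_eq hv (hst.isCoveringPair_of_eq hv hlam e) (eq_comp_swap e)
    omega
  | succ k ih =>
    by_cases hne : x = y
    · exact hne ▸ le_rfl
    obtain ⟨z, s, t, hst, e, hz⟩ := exists_greedy hv hlam h hne
    have hc := hst.isCoveringPair_of_eq hv hlam e
    have := inversions_eq hv hc (eq_comp_swap e)
    exact (ih hz (by omega)).trans (lt_of_entries_eq hv.injective hc (eq_comp_swap e)).le

theorem exists_greedy_of_lt (hv : IsConsistentAntiLinearization v)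
    (hlam : IsRegularPartition (Nat.card S) lam) (h : x < y) :
    ∃ (z : DominantPoset v lam) (s t : S), IsGreedyPair (pos v) (entries x) (entries y) s t ∧
      entries z = entries y ∘ Equiv.swap s t ∧ x ≤ z ∧
      IsCoveringPair (pos v) (entries z) s t := by
  obtain ⟨z, s, t, hst, e, hz⟩ := exists_greedy hv hlam (prefixLE_of_le hv.injective h.le) h.ne
  exact ⟨z, s, t, hst, e, le_of_prefixLE hv hlam hz, hst.isCoveringPair_of_eq hv hlam e⟩

theorem inversions_le (hv : IsConsistentAntiLinearization v)
    (hlam : IsRegularPartition (Nat.card S) lam) (h : x ≤ y) :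
    inversions (pos v) (entries x) ≤ inversions (pos v) (entries y) := by
  induction hk : inversions (pos v) (entries y) generalizing y with
  | zero =>
    rcases h.eq_or_lt with rfl | hlt
    · exact hk.le
    obtain ⟨z, s, t, -, e, hxz, hc⟩ := exists_greedy_of_lt hv hlam hlt
    have := inversions_eq hv hc (eq_comp_swap e)
    omega
  | succ k ih =>
    rcases h.eq_or_lt with rfl | hlt
    · exact hk.le
    obtain ⟨z, s, t, -, e, hxz, hc⟩ := exists_greedy_of_lt hv hlam hlt
    have := inversions_eq hv hc (eq_comp_swap e)
    have := ih hxz (by omega)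
    omega

theorem inversions_lt (hv : IsConsistentAntiLinearization v)
    (hlam : IsRegularPartition (Nat.card S) lam) (h : x < y) :
    inversions (pos v) (entries x) < inversions (pos v) (entries y) := by
  obtain ⟨z, s, t, -, e, hxz, hc⟩ := exists_greedy_of_lt hv hlam h
  have := inversions_eq hv hc (eq_comp_swap e)
  have := inversions_le hv hlam hxz
  omega

theorem covBy_of_inversions (hv : IsConsistentAntiLinearization v)
    (hlam : IsRegularPartition (Nat.card S) lam) (h : x < y)
    (hr : inversions (pos v) (entries y) ≤ inversions (pos v) (entries x) + 1) : x ⋖ y := by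
  refine ⟨h, fun z hxz hzy => ?_⟩
  have := inversions_lt hv hlam hxz
  have := inversions_lt hv hlam hzy
  omega

theorem covBy_iff (hv : IsConsistentAntiLinearization v)
    (hlam : IsRegularPartition (Nat.card S) lam) :
    x ⋖ y ↔ ∃ s t, IsCoveringPair (pos v) (entries x) s t ∧
      entries y = entries x ∘ Equiv.swap s t := by
  constructor
  · intro h
    obtain ⟨z, s, t, -, e, hxz, hc⟩ := exists_greedy_of_lt hv hlam h.lt
    have hzy := lt_of_entries_eq hv.injective hc (eq_comp_swap e)
    obtain rfl : x = z := by
      by_contra hne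
      exact h.2 (lt_of_le_of_ne hxz hne) hzy
    exact ⟨s, t, hc, eq_comp_swap e⟩
  · rintro ⟨s, t, hc, e⟩
    exact covBy_of_inversions hv hlam (lt_of_entries_eq hv.injective hc e)
      (inversions_eq hv hc e).le

theorem inversions_eq_of_covBy (hv : IsConsistentAntiLinearization v)
    (hlam : IsRegularPartition (Nat.card S) lam) (h : x ⋖ y) :
    inversions (pos v) (entries y) = inversions (pos v) (entries x) + 1 := by
  obtain ⟨s, t, hc, e⟩ := (covBy_iff hv hlam).1 h
  exact inversions_eq hv hc e

instance Orbit.instFinite (lam : Fin m → ℕ) : Finite (Orbit lam) :=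
  Finite.of_surjective (fun σ : Equiv.Perm (Fin m) => (⟨lam ∘ σ, σ, rfl⟩ : Orbit lam))
    fun ⟨_, σ, h⟩ => ⟨σ, Orbit.ext h.symm⟩

end DominantOrder

/-! ### Least and greatest dominant compositions -/

section Bounded

variable {S : Type*} [PartialOrder S] {m : ℕ} {v : S → Fin m} {lam : Fin m → ℕ}

/-- Two functions that decrease along the same linear order and have the same positive values
coincide. -/
theorem eq_of_sorted {ι β : Type*} [Finite ι] [LinearOrder β] {K : ι → β}
    (hK : Function.Injective K) {f g : ι → ℕ} (hf : ∀ s t, K s < K t → f t < f s)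
    (hg : ∀ s t, K s < K t → g t < g s) (hfg : ∀ s, 0 < f s → ∃ t, g t = f s)
    (hgf : ∀ s, 0 < g s → ∃ t, f t = g s) : f = g := by
  by_contra hne
  obtain ⟨r, hr⟩ := Function.ne_iff.1 hne
  -- at the largest disagreeing value, the two functions attain it at different places
  obtain ⟨s, hs, hmax⟩ := Set.exists_max_image {r | f r ≠ g r} (fun r => max (f r) (g r))
    (Set.toFinite _) ⟨r, hr⟩
  have hs : f s ≠ g s := hs
  have aux : ∀ {f g : ι → ℕ}, (∀ s t, K s < K t → f t < f s) → (∀ s t, K s < K t → g t < g s) →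
      (∀ s, 0 < f s → ∃ t, g t = f s) → g s < f s →
      ∃ t, f t ≠ g t ∧ f s < f t := by
    intro f g hf hg hfg hlt
    obtain ⟨t, ht⟩ := hfg s (by omega)
    rcases lt_trichotomy (K t) (K s) with h | h | h
    · have := hf t s h
      exact ⟨t, by omega, this⟩
    · rw [hK h] at ht
      omega
    · have := hg s t h
      omega
  rcases lt_or_gt_of_ne hs with h | h
  · obtain ⟨t, h1, h2⟩ := aux hg hf hgf h
    have := hmax t h1.symm
    simp only [max_def] at this
    split_ifs at this <;> omega
  · obtain ⟨t, h1, h2⟩ := aux hf hg hfg h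
    have := hmax t h1
    simp only [max_def] at this
    split_ifs at this <;> omega

theorem ncard_le_entries (hv : Function.Injective v) (x y : DominantPoset v lam) {c : ℕ}
    (hc : 0 < c) : {s | c ≤ entries x s}.ncard = {s | c ≤ entries y s}.ncard := by
  have aux : ∀ x : DominantPoset v lam, {s | c ≤ entries x s}.ncard = {l | c ≤ lam l}.ncard := by
    intro x
    have h := blockCount_comp_eq (p := 0) (q := m) hv x.property.1 hc
    rw [← ncard_le_val x.val c]
    simpa [blockCount, pos, entries] using h.symm
  rw [aux x, aux y]

/-- A disorder of incomparable elements with the smallest possible distance is a covering pair. -/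
theorem exists_isCoveringPair {w f : S → ℕ} (hf : Function.Injective f) {s t : S}
    (hst : w s < w t) (hlt : f t < f s) (hnot : ¬ t < s) : ∃ s' t', IsCoveringPair w f s' t' := by
  induction hn : w t - w s using Nat.strong_induction_on generalizing s t with
  | _ n ih =>
    by_cases hall : ∀ r, w s < w r → w r < w t → f r < f t ∨ f s < f r
    · exact ⟨s, t, hst, hlt, hnot, hall⟩
    push Not at hall
    obtain ⟨r, hsr, hrt, h1, h2⟩ := hall
    have h3 : f r ≠ f s := fun e => by
      rw [hf e] at hsr
      omega
    have h4 : f r ≠ f t := fun e => by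
      rw [hf e] at hrt
      omega
    by_cases htr : t < r
    · exact ih (w r - w s) (by omega) hsr (by omega) (fun h => hnot (htr.trans h)) rfl
    · exact ih (w t - w r) (by omega) hrt (by omega) htr rfl

variable [Finite S]

/-- There is a dominant composition with decreasing entries. -/
theorem exists_decreasing (hv : IsConsistentAntiLinearization v)
    (hlam : IsRegularPartition (Nat.card S) lam) :
    ∃ x : DominantPoset v lam, ∀ s t, v s ≤ v t → entries x t ≤ entries x s := by
  have hn : Nat.card S ≤ m := by simpa using Nat.card_le_card_of_injective v hv.injective
  have hlt : ∀ s, {r | v r < v s}.ncard < Nat.card S := fun s => by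
    rw [← Set.ncard_univ]
    exact Set.ncard_lt_ncard ⟨Set.subset_univ _, fun h => lt_irrefl (v s) (h (Set.mem_univ s))⟩
  let ρ : S → Fin m := fun s => ⟨{r | v r < v s}.ncard, (hlt s).trans_le hn⟩
  have hρlt : ∀ s t, v s < v t → ρ s < ρ t := fun s t hst =>
    Set.ncard_lt_ncard ⟨fun r (hr : v r < v s) => hr.trans hst,
      fun h => lt_irrefl (v s) (h (show s ∈ {r | v r < v t} from hst))⟩
  have hρ : Function.Injective ρ := by
    intro s t hst
    rcases lt_trichotomy (v s) (v t) with h | h | h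
    · exact absurd hst (hρlt s t h).ne
    · exact hv.injective h
    · exact absurd hst (hρlt t s h).ne'
  obtain ⟨σ, hσ⟩ := Equiv.Perm.exists_extending_pair v ρ hv.injective hρ
  have hdecr : ∀ s t, v s ≤ v t → lam (σ (v t)) ≤ lam (σ (v s)) := by
    intro s t hst
    rcases hst.eq_or_lt with e | h
    · rw [e]
    · rw [hσ, hσ]
      exact (hlam.strict _ _ (hρlt s t h) (hlt t)).le
  refine ⟨⟨⟨lam ∘ σ, σ, rfl⟩, fun l hl => hlam.zero _ ?_, fun s t hst =>
    hdecr s t (hv.strictAnti hst).le⟩, hdecr⟩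
  by_contra! hcon
  -- `ρ` takes all values below `n`
  have hbij : Function.Bijective (fun s => (⟨ρ s, hlt s⟩ : Fin (Nat.card S))) := by
    rw [Nat.bijective_iff_injective_and_card]
    exact ⟨fun s t h => hρ (Fin.ext (by simpa using h)), by simp⟩
  obtain ⟨s, hs⟩ := hbij.2 ⟨σ l, hcon⟩
  refine hl ⟨s, σ.injective ?_⟩
  rw [hσ]
  exact Fin.ext (by simpa using hs)

theorem isBot_of_decreasing (hv : IsConsistentAntiLinearization v)
    (hlam : IsRegularPartition (Nat.card S) lam) {x : DominantPoset v lam}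
    (hx : ∀ s t, v s ≤ v t → entries x t ≤ entries x s) : IsBot x := by
  classical
  intro y
  refine le_of_prefixLE hv hlam fun p c => ?_
  by_cases hall : ∀ r, pos v r < p → c ≤ entries x r
  · exact blockCount_le fun r _ hr _ => hall r hr
  push Not at hall
  obtain ⟨r, hr, hrc⟩ := hall
  have e : blockCount (pos v) (entries x) 0 p c = {s | c ≤ entries x s}.ncard := by
    unfold blockCount
    congr 1
    ext s
    refine ⟨fun h => h.2.2, fun h : c ≤ entries x s => ⟨Nat.zero_le _, ?_, h⟩⟩
    by_contra! hps
    have := hx r s (hr.le.trans hps)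
    omega
  rw [e, ncard_le_entries hv.injective x y (by omega)]
  exact Set.ncard_le_ncard fun s hs => hs.2.2

theorem inversions_eq_zero_of_isBot (hv : IsConsistentAntiLinearization v)
    (hlam : IsRegularPartition (Nat.card S) lam) {x : DominantPoset v lam} (hx : IsBot x) :
    inversions (pos v) (entries x) = 0 := by
  obtain ⟨x₀, h₀⟩ := exists_decreasing hv hlam
  obtain rfl : x = x₀ := le_antisymm (hx x₀) (isBot_of_decreasing hv hlam h₀ x)
  unfold inversions
  rw [Set.ncard_eq_zero, Set.eq_empty_iff_forall_notMem]
  rintro p ⟨h1, h2⟩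
  exact absurd (h₀ p.1 p.2 h1.le) (not_le.2 h2)

/-- A maximal dominant composition decreases along the right-to-left postorder. -/
theorem sorted_of_isMax (hv : IsConsistentAntiLinearization v)
    (hlam : IsRegularPartition (Nat.card S) lam) {x : DominantPoset v lam} (hx : IsMax x) (s t : S)
    (hst : key (pos v) s < key (pos v) t) : entries x t < entries x s := by
  classical
  have hw := hv.isPostorder
  have hinj := entries_injective hv.injective hlam x
  by_contra! hle
  have hne : s ≠ t := fun e => hst.ne (by rw [e])
  have hlt : entries x s < entries x t := lt_of_le_of_ne hle fun e => hne (hinj e)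
  have hpos : pos v t < pos v s := by
    by_contra! hpos
    have hpos : pos v s < pos v t := lt_of_le_of_ne hpos fun e => hne (hw.injective e)
    exact absurd (entries_monotone x (le_of_key_le hw hst.le hpos)) (not_le.2 hlt)
  obtain ⟨a, b, hab⟩ := exists_isCoveringPair (w := pos v) hinj hpos hlt
    fun h => absurd (key_lt_of_lt hw h) hst.not_gt
  obtain ⟨y, hy⟩ := exists_comp_swap hv.injective x (hab.monotone_comp_swap hw (entries_monotone x))
  exact hx.not_lt (lt_of_entries_eq hv.injective hab hy)

theorem isBoundedPoset (hv : IsConsistentAntiLinearization v)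
    (hlam : IsRegularPartition (Nat.card S) lam) : IsBoundedPoset (DominantPoset v lam) := by
  obtain ⟨x₀, h₀⟩ := exists_decreasing hv hlam
  have hmax : ∀ x : DominantPoset v lam, ∃ M, x ≤ M ∧ IsMax M := fun x => by
    obtain ⟨M, hxM, hM⟩ := Finite.exists_le_maximal (p := fun _ : DominantPoset v lam => True)
      (a := x) trivial
    exact ⟨M, hxM, fun y hy => hM.2 trivial hy⟩
  obtain ⟨M, -, hM⟩ := hmax x₀
  refine ⟨⟨x₀, isBot_of_decreasing hv hlam h₀⟩, M, fun y => ?_⟩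
  obtain ⟨M', hyM', hM'⟩ := hmax y
  obtain rfl : M' = M := eq_of_entries_eq <|
    eq_of_sorted (key_injective hv.isPostorder) (sorted_of_isMax hv hlam hM')
      (sorted_of_isMax hv hlam hM) (fun s hs => exists_entries_eq M' M hs)
      fun s hs => exists_entries_eq M M' hs
  exact hyM'

end Bounded

/-! ### Shellability and subthinness -/

section Shelling

variable {S : Type*} [PartialOrder S] [DecidableEq S] {m : ℕ} {v : S → Fin m}
  {lam : Fin m → ℕ} {x y z : DominantPoset v lam} {s t : S}

open Classical in
/-- The label of a covering relation of dominant compositions is that of the pair of exchanged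
positions; the value at other pairs is arbitrary. -/
noncomputable def edgeLabel (x y : DominantPoset v lam) : ℕᵒᵈ ×ₗ (ℕᵒᵈ ×ₗ ℕ) :=
  if h : ∃ p : S × S, IsCoveringPair (pos v) (entries x) p.1 p.2 ∧
      entries y = entries x ∘ Equiv.swap p.1 p.2 then
    label (pos v) h.choose.1 h.choose.2
  else toLex (OrderDual.toDual 0, toLex (OrderDual.toDual 0, 0))

theorem swap_ne_of_lt (hxy : x ≠ y) {a b c d : S}
    (h1 : entries z = entries x ∘ Equiv.swap a b) (h2 : entries y = entries z ∘ Equiv.swap c d) :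
    Equiv.swap a b ≠ Equiv.swap c d := by
  intro e
  apply hxy
  apply eq_of_entries_eq
  rw [h2, h1, e, Function.comp_assoc, ← Equiv.coe_trans, Equiv.swap_swap]
  rfl

/-- Three exchanges of three positions cannot all be covering: the exchange of the outer two has
the middle entry in between. -/
theorem not_three_isCoveringPair {w f : S → ℕ} (hw : Function.Injective w) {α β γ : S}
    (h1 : α ≠ β) (h2 : α ≠ γ) (h3 : β ≠ γ)
    (h : ∀ i j, w i < w j →
      Equiv.swap i j ∈ [Equiv.swap α β, Equiv.swap α γ, Equiv.swap β γ] →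
        IsCoveringPair w f i j) : False := by
  have aux : ∀ i j k, w i < w j → w j < w k → IsCoveringPair w f i j → IsCoveringPair w f i k →
      IsCoveringPair w f j k → False := by
    intro i j k hij hjk h1 h2 h3
    have := h2.between j hij hjk
    have := h1.disorder
    have := h3.disorder
    omega
  have n1 : w α ≠ w β := fun e => h1 (hw e)
  have n2 : w α ≠ w γ := fun e => h2 (hw e)
  have n3 : w β ≠ w γ := fun e => h3 (hw e)
  have c1 := fun hh => h α β hh (by simp)
  have c2 := fun hh => h α γ hh (by simp)
  have c3 := fun hh => h β γ hh (by simp)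
  have c1' := fun hh => h β α hh (by simp [Equiv.swap_comm])
  have c2' := fun hh => h γ α hh (by simp [Equiv.swap_comm])
  have c3' := fun hh => h γ β hh (by simp [Equiv.swap_comm])
  rcases lt_or_gt_of_ne n1 with g1 | g1 <;> rcases lt_or_gt_of_ne n2 with g2 | g2 <;>
    rcases lt_or_gt_of_ne n3 with g3 | g3
  · exact aux α β γ g1 g3 (c1 g1) (c2 g2) (c3 g3)
  · exact aux α γ β g2 g3 (c2 g2) (c1 g1) (c3' g3)
  · omega
  · exact aux γ α β g2 g1 (c2' g2) (c3' g3) (c1 g1)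
  · exact aux β α γ g1 g2 (c1' g1) (c3 g3) (c2 g2)
  · omega
  · exact aux β γ α g3 g2 (c3 g3) (c1' g1) (c2' g2)
  · exact aux γ β α g3 g1 (c3' g3) (c2' g2) (c1' g1)

variable [Finite S]

theorem edgeLabel_eq (hv : IsConsistentAntiLinearization v)
    (hlam : IsRegularPartition (Nat.card S) lam) (h : IsCoveringPair (pos v) (entries x) s t)
    (e : entries y = entries x ∘ Equiv.swap s t) : edgeLabel x y = label (pos v) s t := by
  have hex : ∃ p : S × S, IsCoveringPair (pos v) (entries x) p.1 p.2 ∧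
      entries y = entries x ∘ Equiv.swap p.1 p.2 := ⟨(s, t), h, e⟩
  rw [edgeLabel, dif_pos hex]
  obtain ⟨h1, h2⟩ := hex.choose_spec
  obtain ⟨e1, e2⟩ := swap_eq_swap_of_position h1.position h.position
    (perm_eq_of_comp_eq hv hlam (h2.symm.trans e))
  rw [e1, e2]

/-- `z` arises from `y` by the greedy exchange of the interval from `x` to `y`. -/
def IsGreedyCoatom (x y z : DominantPoset v lam) : Prop :=
  x ≤ z ∧ ∃ s t, IsGreedyPair (pos v) (entries x) (entries y) s t ∧
    entries z = entries y ∘ Equiv.swap s t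

theorem exists_isGreedyCoatom (hv : IsConsistentAntiLinearization v)
    (hlam : IsRegularPartition (Nat.card S) lam) (h : x < y) : ∃ z, IsGreedyCoatom x y z := by
  obtain ⟨z, s, t, hst, e, hxz, -⟩ := exists_greedy_of_lt hv hlam h
  exact ⟨z, hxz, s, t, hst, e⟩

theorem IsGreedyCoatom.covBy (hv : IsConsistentAntiLinearization v)
    (hlam : IsRegularPartition (Nat.card S) lam) (h : IsGreedyCoatom x y z) : z ⋖ y := by
  obtain ⟨-, s, t, hst, e⟩ := h
  exact (covBy_iff hv hlam).2 ⟨s, t, hst.isCoveringPair_of_eq hv hlam e, eq_comp_swap e⟩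

theorem mul_swap_eq (hv : IsConsistentAntiLinearization v)
    (hlam : IsRegularPartition (Nat.card S) lam) {z' : DominantPoset v lam} {a b c d a' b' c' d' : S}
    (h1 : entries z = entries x ∘ Equiv.swap a b) (h2 : entries y = entries z ∘ Equiv.swap c d)
    (h1' : entries z' = entries x ∘ Equiv.swap a' b')
    (h2' : entries y = entries z' ∘ Equiv.swap c' d') :
    Equiv.swap a b * Equiv.swap c d = Equiv.swap a' b' * Equiv.swap c' d' := by
  refine perm_eq_of_comp_eq (x := x) hv hlam ?_
  rw [h1] at h2
  rw [h1'] at h2'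
  exact h2.symm.trans h2'

/-- A descent can be exchanged for the greedy chain, whose first label is smaller because the two
factorizations of the same permutation share a transposition. -/
theorem exists_smaller_label (hv : IsConsistentAntiLinearization v)
    (hlam : IsRegularPartition (Nat.card S) lam) (hxz : x ⋖ z) (hzy : z ⋖ y)
    (hdesc : ¬ edgeLabel x z < edgeLabel z y) :
    ∃ z', x ⋖ z' ∧ z' ⋖ y ∧ edgeLabel x z' < edgeLabel x z := by
  have hw := hv.isPostorder
  have hxy := hxz.lt.trans hzy.lt
  obtain ⟨z', hz'⟩ := exists_isGreedyCoatom hv hlam hxy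
  have hz'y := hz'.covBy hv hlam
  have hr1 := inversions_eq_of_covBy hv hlam hxz
  have hr2 := inversions_eq_of_covBy hv hlam hzy
  have hr3 := inversions_eq_of_covBy hv hlam hz'y
  have hxz'lt : x < z' := lt_of_le_of_ne hz'.1 fun e => by
    rw [← e] at hr3
    omega
  have hxz' : x ⋖ z' := covBy_of_inversions hv hlam hxz'lt (by omega)
  obtain ⟨u, hu⟩ := exists_isGreedyCoatom hv hlam hxz'lt
  obtain rfl : u = x := by
    by_contra hne
    exact hxz'.2 (lt_of_le_of_ne hu.1 (Ne.symm hne)) (hu.covBy hv hlam).lt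
  obtain ⟨-, c', d', hg, e'⟩ := hz'
  obtain ⟨-, a', b', hg', e''⟩ := hu
  have hc' := hg.isCoveringPair_of_eq hv hlam e'
  have ha' := hg'.isCoveringPair_of_eq hv hlam e''
  obtain ⟨a, b, ha, e1⟩ := (covBy_iff hv hlam).1 hxz
  obtain ⟨c, d, hc, e2⟩ := (covBy_iff hv hlam).1 hzy
  have l1 := edgeLabel_eq hv hlam ha e1
  have l2 := edgeLabel_eq hv hlam hc e2
  have l1' := edgeLabel_eq hv hlam ha' (eq_comp_swap e'')
  have l2' := edgeLabel_eq hv hlam hc' (eq_comp_swap e')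
  have hlt : label (pos v) a' b' < label (pos v) c' d' := by
    rw [e'] at hg'
    exact hg.label_lt hw hg'
  refine ⟨z', hxz', hz'y, ?_⟩
  rw [l1, l2] at hdesc
  rw [l1, l1']
  have hmul := mul_swap_eq hv hlam e1 e2 (eq_comp_swap e'') (eq_comp_swap e')
  have hne : ¬ (a' = a ∧ b' = b) := by
    rintro ⟨rfl, rfl⟩
    have : Equiv.swap c d = Equiv.swap c' d' := mul_left_cancel hmul
    obtain ⟨rfl, rfl⟩ := swap_eq_swap_of_position hc.position hc'.position this
    exact hdesc hlt
  have hswap : Equiv.swap a' b' ≠ Equiv.swap a b := fun e =>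
    hne (swap_eq_swap_of_position ha'.position ha.position e)
  rcases swap_eq_or_eq_of_mul_eq ha.ne hc.ne
    ha'.ne (swap_ne_of_lt hxy.ne e1 e2) hmul hswap with e | e
  · obtain ⟨rfl, rfl⟩ := swap_eq_swap_of_position ha'.position hc.position e
    exact lt_of_le_of_ne (not_lt.1 hdesc) fun e => hne (label_injective hw e)
  · obtain ⟨rfl, rfl⟩ := swap_eq_swap_of_position hc'.position ha.position e
    exact hlt

theorem isELShellable (hv : IsConsistentAntiLinearization v)
    (hlam : IsRegularPartition (Nat.card S) lam) : IsELShellable (DominantPoset v lam) := by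
  refine ⟨ℕᵒᵈ ×ₗ (ℕᵒᵈ ×ₗ ℕ), inferInstance, edgeLabel,
    isELLabelling_of_greedy (G := IsGreedyCoatom) (fun x y h => exists_isGreedyCoatom hv hlam h)
      (fun x y z h => ⟨h.1, h.covBy hv hlam⟩) ?_
      fun x z y h1 h2 h3 => exists_smaller_label hv hlam h1 h2 h3⟩
  rintro x y z z' u ⟨-, s, t, hst, e⟩ hxz' hz'y hne ⟨-, s₁, t₁, hst₁, e₁⟩
  obtain ⟨a, b, hab, e'⟩ := (covBy_iff hv hlam).1 hz'y
  rw [edgeLabel_eq hv hlam hab e',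
    edgeLabel_eq hv hlam (hst₁.isCoveringPair_of_eq hv hlam e₁) (eq_comp_swap e₁)]
  refine IsGreedyPair.label_le_of_ne (s := s) (t := t) hv.isPostorder (entries_monotone z')
    (entries_injective hv.injective hlam z') (prefixLE_of_le hv.injective hxz') hab
    (e' ▸ hst) ?_ hst₁
  rintro ⟨rfl, rfl⟩
  exact hne (eq_of_entries_eq ((eq_comp_swap e').trans e.symm))

theorem encard_Ioo_le_two (hv : IsConsistentAntiLinearization v)
    (hlam : IsRegularPartition (Nat.card S) lam)
    (hr : inversions (pos v) (entries y) = inversions (pos v) (entries x) + 2) :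
    (Set.Ioo x y).encard ≤ 2 := by
  have hmid : ∀ z ∈ Set.Ioo x y, ∃ p q : S × S,
      IsCoveringPair (pos v) (entries x) p.1 p.2 ∧ entries z = entries x ∘ Equiv.swap p.1 p.2 ∧
      IsCoveringPair (pos v) (entries z) q.1 q.2 ∧ entries y = entries z ∘ Equiv.swap q.1 q.2 := by
    rintro z ⟨hxz, hzy⟩
    have h1 := inversions_lt hv hlam hxz
    have h2 := inversions_lt hv hlam hzy
    obtain ⟨a, b, h, e⟩ := (covBy_iff hv hlam).1 (covBy_of_inversions hv hlam hxz (by omega))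
    obtain ⟨c, d, h', e'⟩ := (covBy_iff hv hlam).1 (covBy_of_inversions hv hlam hzy (by omega))
    exact ⟨(a, b), (c, d), h, e, h', e'⟩
  have hfin : (Set.Ioo x y).Finite := Set.toFinite _
  rw [← hfin.cast_ncard_eq]
  by_contra hcon
  have hcon : 2 < (Set.Ioo x y).ncard := by
    by_contra hle
    exact hcon (by exact_mod_cast not_lt.1 hle)
  obtain ⟨z₁, z₂, z₃, hz₁, hz₂, hz₃, h₁₂, h₁₃, h₂₃⟩ := (Set.two_lt_ncard_iff hfin).1 hcon
  obtain ⟨p, q, hp, e, hq, e'⟩ := hmid z₁ hz₁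
  obtain ⟨p₂, q₂, hp₂, e₂, hq₂, e₂'⟩ := hmid z₂ hz₂
  obtain ⟨p₃, q₃, hp₃, e₃, hq₃, e₃'⟩ := hmid z₃ hz₃
  obtain ⟨α, β, γ, n1, n2, n3, hall⟩ := exists_of_three_factorizations
    hp.ne hq.ne hp₂.ne
    hp₃.ne (swap_ne_of_lt (hz₁.1.trans hz₁.2).ne e e')
    (mul_swap_eq hv hlam e e' e₂ e₂') (mul_swap_eq hv hlam e e' e₃ e₃')
    (fun h => h₁₂ (eq_of_entries_eq (by rw [e, e₂, h])))
    (fun h => h₁₃ (eq_of_entries_eq (by rw [e, e₃, h])))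
    (fun h => h₂₃ (eq_of_entries_eq (by rw [e₂, e₃, h])))
  refine not_three_isCoveringPair hv.isPostorder.injective (f := entries x) n1 n2 n3 ?_
  intro i j hij hmem
  have := hall _ hmem
  simp only [List.mem_cons, List.not_mem_nil, or_false] at this
  rcases this with h | h | h
  · obtain ⟨rfl, rfl⟩ := swap_eq_swap_of_position hij hp.position h
    exact hp
  · obtain ⟨rfl, rfl⟩ := swap_eq_swap_of_position hij hp₂.position h
    exact hp₂
  · obtain ⟨rfl, rfl⟩ := swap_eq_swap_of_position hij hp₃.position h
    exact hp₃

theorem isGradedPoset (hv : IsConsistentAntiLinearization v)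
    (hlam : IsRegularPartition (Nat.card S) lam) : IsGradedPoset (DominantPoset v lam) := by
  intro x y c c' h h'
  have h1 := h.length_add fun x y => inversions_eq_of_covBy hv hlam
  have h2 := h'.length_add fun x y => inversions_eq_of_covBy hv hlam
  omega

theorem isRankFunction (hv : IsConsistentAntiLinearization v)
    (hlam : IsRegularPartition (Nat.card S) lam) :
    IsRankFunction (fun d : DominantPoset v lam => disorderRank v d.val.val) := by
  intro x y c hx h
  have h1 := h.length_add fun x y => inversions_eq_of_covBy hv hlam
  have h2 := inversions_eq_zero_of_isBot hv hlam hx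
  simp only [disorderRank_eq]
  omega

theorem isSubthin (hv : IsConsistentAntiLinearization v)
    (hlam : IsRegularPartition (Nat.card S) lam) : IsSubthin (DominantPoset v lam) := by
  refine ⟨isGradedPoset hv hlam, fun x y c h hlen => encard_Ioo_le_two hv hlam ?_⟩
  have h1 := h.length_add fun x y => inversions_eq_of_covBy hv hlam
  omega

end Shelling

/-! ### Bubble-sort -/

section Admissible

variable {S : Type*} {m : ℕ} {v : S → Fin m} {d : Fin m → ℕ}

theorem isAdmissible_iff : IsAdmissible v d ↔
    ∀ p : Fin m, blockCount Fin.val d 0 (p + 1) 1 ≤ {s : S | v s ≤ p}.ncard := by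
  have h : ∀ p : Fin m, {j : Fin m | j ≤ p ∧ 0 < d j} =
      {j : Fin m | 0 ≤ j.val ∧ j.val < p + 1 ∧ 1 ≤ d j} := fun p => by
    ext j
    simp only [Set.mem_ofPred_eq, Fin.le_def]
    omega
  unfold IsAdmissible blockCount
  simp only [h]

theorem isAdmissible_of_surjective (hsurj : Function.Surjective v) (hv : Function.Injective v) :
    IsAdmissible v d := by
  intro k
  rw [← Set.ncard_image_of_injective _ hv]
  refine Set.ncard_le_ncard fun j hj => ?_
  obtain ⟨s, rfl⟩ := hsurj j
  exact ⟨s, hj.1, rfl⟩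

/-- Prefixes in which `d` vanishes outside `v(S)` satisfy the admissibility bound. -/
theorem ncard_pos_le (hv : Function.Injective v) {p : Fin m}
    (h : ∀ l ≤ p, l ∉ Set.range v → d l = 0) :
    {j : Fin m | j ≤ p ∧ 0 < d j}.ncard ≤ {s : S | v s ≤ p}.ncard := by
  rw [← Set.ncard_image_of_injective {s : S | v s ≤ p} hv]
  refine Set.ncard_le_ncard fun j hj => ?_
  by_cases hl : j ∈ Set.range v
  · obtain ⟨s, rfl⟩ := hl
    exact ⟨s, hj.1, rfl⟩
  · have := h j hj.1 hl
    have := hj.2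
    omega

end Admissible

section BubbleSort

variable {S : Type*} [PartialOrder S] {m : ℕ} {v : S → Fin m} {d e : Fin m → ℕ} {k : Fin m}
  {t : S}

theorem isDominant_iff : IsDominant v d ↔ ∀ l, IsDominantAt v l d :=
  ⟨fun h l => ⟨h.1 l, fun t ht s hst => ht ▸ h.2 s t hst⟩,
    fun h => ⟨fun l => (h l).1, fun s t hst => (h (v t)).2 t rfl s hst⟩⟩

/-- `v t` is the position selected by stage `k`: it is the largest position of a maximal element
among those before `k` with an entry smaller than that at `k`. -/
structure IsSelected (v : S → Fin m) (k : Fin m) (d : Fin m → ℕ) (t : S) : Prop where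
  maximal : Maximal (fun u => v u < k ∧ d (v u) < d k) t
  le : ∀ u, Maximal (fun u => v u < k ∧ d (v u) < d k) u → v u ≤ v t

theorem exists_isSelected (h : (swapCandidates v k d).Nonempty) :
    ∃ t, (swapCandidates v k d).max' h = v t ∧ IsSelected v k d t := by
  classical
  have hmem := Finset.max'_mem _ h
  simp only [swapCandidates, Finset.mem_filter, Finset.mem_univ, true_and] at hmem
  obtain ⟨t, ht, hmax⟩ := hmem
  refine ⟨t, ht.symm, hmax, fun u hu => ?_⟩
  rw [ht]
  exact Finset.le_max' _ _ (by simpa [swapCandidates] using ⟨u, rfl, hu⟩)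

theorem IsDominant.isAdmissible (hv : Function.Injective v) (h : IsDominant v d) :
    IsAdmissible v d :=
  fun _ => ncard_pos_le hv fun l _ => h.1 l

theorem IsSelected.lt (h : IsSelected v k d t) : v t < k := h.maximal.1.1

theorem IsSelected.entry_lt (h : IsSelected v k d t) : d (v t) < d k := h.maximal.1.2

theorem IsSelected.step (h : IsSelected v k d t) : BruhatStep (d ∘ Equiv.swap (v t) k) d := by
  refine ⟨v t, k, h.lt, by simpa using h.entry_lt, ?_⟩
  rw [Function.comp_assoc, ← Equiv.coe_trans, Equiv.swap_swap]
  rfl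

theorem IsSelected.isDominantAt (hv : IsConsistentAntiLinearization v) (h : IsSelected v k d t)
    (hd : ∀ l < k, IsDominantAt v l d) : ∀ l < k, IsDominantAt v l (d ∘ Equiv.swap (v t) k) := by
  have hlt := h.lt
  have hent := h.entry_lt
  have hmono : ∀ l < k, d l ≤ (d ∘ Equiv.swap (v t) k) l := by
    intro l hl
    by_cases hlt' : l = v t
    · subst hlt'
      simpa using hent.le
    · simp [Equiv.swap_apply_of_ne_of_ne hlt' hl.ne]
  intro l hl
  refine ⟨fun hr => ?_, ?_⟩
  · have h1 : l ≠ v t := fun e => hr ⟨t, e.symm⟩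
    simp [Equiv.swap_apply_of_ne_of_ne h1 hl.ne, (hd l hl).1 hr]
  · rintro r rfl s hrs
    have hs : v s < k := (hv.strictAnti hrs).trans hl
    by_cases hr : r = t
    · subst hr
      have hne : v s ≠ v r := (hv.strictAnti hrs).ne
      simp only [Function.comp, Equiv.swap_apply_left, Equiv.swap_apply_of_ne_of_ne hne hs.ne]
      by_contra! hcon
      exact absurd (h.maximal.2 ⟨hs, hcon⟩ hrs.le) (not_le_of_gt hrs)
    · have hne : v r ≠ v t := fun e => hr (hv.injective e)
      refine le_trans ?_ (hmono _ hs)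
      simpa [Equiv.swap_apply_of_ne_of_ne hne hl.ne] using (hd (v r) hl).2 r rfl s hrs

theorem IsSelected.isAdmissible (hv : IsConsistentAntiLinearization v) (h : IsSelected v k d t)
    (hd : ∀ l < k, IsDominantAt v l d) (hadm : IsAdmissible v d) :
    IsAdmissible v (d ∘ Equiv.swap (v t) k) := by
  intro p
  rcases lt_or_ge p k with hp | hp
  · exact ncard_pos_le hv.injective fun l hl =>
      (h.isDominantAt hv hd l (hl.trans_lt hp)).1
  · have e : blockCount Fin.val d 0 (p + 1) 1 =
        blockCount Fin.val (d ∘ Equiv.swap (v t) k) 0 (p + 1) 1 := by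
      have := blockCount_comp_swap (w := Fin.val) (f := d ∘ Equiv.swap (v t) k) h.lt
        (by simpa using h.entry_lt) (p + 1) 1
      rw [Function.comp_assoc, ← Equiv.coe_trans, Equiv.swap_swap, Equiv.coe_refl,
        Function.comp_id] at this
      have hp : (k : ℕ) ≤ p := hp
      rw [this, if_neg (by omega)]
      rfl
    have h1 := isAdmissible_iff.1 hadm p
    rw [e] at h1
    refine le_trans (le_of_eq ?_) h1
    unfold blockCount
    congr 1
    ext j
    simp only [Set.mem_ofPred_eq, Fin.le_def]
    omega

theorem bubbleStage_of_isDominantAt (h : IsDominantAt v k d) : bubbleStage v k d = d := by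
  rw [bubbleStage, dif_neg fun H => H.1 h]

theorem bubbleSort_of_isDominant (h : IsDominant v d) : bubbleSort v d = d := by
  unfold bubbleSort
  induction List.finRange m with
  | nil => rfl
  | cons k l ih =>
    rw [List.foldl_cons, bubbleStage_of_isDominantAt (isDominant_iff.1 h k)]
    exact ih

variable [Finite S]

theorem exists_maximal_ge {P : S → Prop} {u : S} (hu : P u) : ∃ t, u ≤ t ∧ Maximal P t :=
  Finite.exists_le_maximal hu

/-- If stage `k` has not been completed then it can proceed: without smaller entries before `k`
the bound of admissibility would fail there. -/
theorem swapCandidates_nonempty (hv : IsConsistentAntiLinearization v)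
    (hadm : IsAdmissible v d) (hk : ¬ IsDominantAt v k d) : (swapCandidates v k d).Nonempty := by
  classical
  suffices H : ∃ u, v u < k ∧ d (v u) < d k by
    obtain ⟨u, hu⟩ := H
    obtain ⟨t, -, ht⟩ := exists_maximal_ge (P := fun u => v u < k ∧ d (v u) < d k) hu
    exact ⟨v t, by simpa [swapCandidates] using ⟨t, rfl, ht⟩⟩
  by_contra! hcon
  apply hk
  refine ⟨fun hr => ?_, ?_⟩
  · by_contra hpos
    have hsub : insert k (v '' {s | v s ≤ k}) ⊆ {j | j ≤ k ∧ 0 < d j} := by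
      rintro j (rfl | ⟨s, hs, rfl⟩)
      · exact ⟨le_rfl, Nat.pos_of_ne_zero hpos⟩
      · have hlt : v s < k := lt_of_le_of_ne hs fun e => hr ⟨s, e⟩
        exact ⟨hs, (Nat.pos_of_ne_zero hpos).trans_le (hcon s hlt)⟩
    have h1 := Set.ncard_le_ncard hsub
    have hnot : k ∉ v '' {s | v s ≤ k} := fun ⟨s, _, e⟩ => hr ⟨s, e⟩
    rw [Set.ncard_insert_of_notMem hnot,
      Set.ncard_image_of_injective _ hv.injective] at h1
    have := hadm k
    omega
  · rintro r rfl s hrs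
    exact hcon s (hv.strictAnti hrs)

/-- Small entries after the selected position, and the element at position `k` itself, belong to
elements below the selected one. -/
theorem IsSelected.lt_of_lt (hv : IsConsistentAntiLinearization v) (h : IsSelected v k d t)
    (hk : ¬ IsDominantAt v k d) {u : S} (htu : v t < v u) (huk : v u ≤ k)
    (hu : v u = k ∨ d (v u) < d k) : u < t := by
  -- a smaller entry above `u` lies below some maximal one, whose position does not exceed `v t`
  have key : ∀ s, u ≤ s → v s < k → d (v s) < d k → u < t := by
    intro s hus hs hds
    obtain ⟨t', hst', ht'⟩ := exists_maximal_ge (P := fun u => v u < k ∧ d (v u) < d k) ⟨hs, hds⟩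
    have hle := h.le t' ht'
    have hut' : u < t' := lt_of_le_of_ne (hus.trans hst') fun e => by
      rw [← e] at hle
      exact absurd htu (not_lt.2 hle)
    rcases hle.eq_or_lt with e | hlt
    · exact hv.injective e ▸ hut'
    · exact hv.consistent t' t u hlt htu hut'
  rcases huk.eq_or_lt with e | hlt
  · have : ∃ s, u < s ∧ d (v s) < d k := by
      by_contra! hcon
      refine hk ⟨fun hr => absurd ⟨u, e⟩ hr, fun r hr s hrs => hcon s ?_⟩
      rwa [hv.injective (e.trans hr.symm)]
    obtain ⟨s, hus, hs⟩ := this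
    exact key s hus.le (e ▸ hv.strictAnti hus) hs
  · exact key u le_rfl hlt (hu.resolve_left hlt.ne)

/-- A dominant composition below `d` stays below the result of a step of bubble-sort. If some
prefix count of `e` were too small, no element after that prefix with a small entry in `d` could
have a large entry in `e`, as then all elements above it would, contradicting an earlier prefix;
hence the prefix that ends at `k` would violate the comparison with `d`. -/
theorem IsSelected.prefixLE (hv : IsConsistentAntiLinearization v) (h : IsSelected v k d t)
    (hd : ∀ l < k, IsDominantAt v l d) (hk : ¬ IsDominantAt v k d) (he : IsDominant v e)
    (hed : PrefixLE Fin.val e d) : PrefixLE Fin.val e (d ∘ Equiv.swap (v t) k) := by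
  have hlt : (v t : ℕ) < k := h.lt
  have hent := h.entry_lt
  have hcount := fun p c => blockCount_comp_swap (w := Fin.val) (f := d ∘ Equiv.swap (v t) k) h.lt
    (by simpa using hent) p c
  simp only [Function.comp_assoc, ← Equiv.coe_trans, Equiv.swap_swap, Equiv.coe_refl,
    Function.comp_id, Function.comp_apply, Equiv.swap_apply_left, Equiv.swap_apply_right] at hcount
  intro p c
  by_contra! hcon
  have hed' := hed p c
  have hsep : (v t : ℕ) < p ∧ p ≤ k ∧ d (v t) < c ∧ c ≤ d k := by
    by_contra hsep
    have := hcount p c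
    rw [if_neg hsep] at this
    omega
  have hcon : blockCount Fin.val e 0 p c ≤ blockCount Fin.val d 0 p c := by
    have := hcount p c
    rw [if_pos hsep] at this
    omega
  obtain ⟨htp, hpk, htc, hck⟩ := hsep
  have hw := hv.isPostorder
  have hlow : ∀ u, u < t → p ≤ v u → v u ≤ k → e (v u) < c := by
    intro u hut hpu huk
    by_contra! hc
    set L := firstPos (pos v) u
    have hLt : L ≤ v t := firstPos_le (w := pos v) hut.le
    have e1 := blockCount_add Fin.val d c (Nat.zero_le L) (show L ≤ p by omega)
    have e2 := blockCount_add Fin.val e c (Nat.zero_le L) (show L ≤ p by omega)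
    have i1 := hed L c
    have habove : ∀ s, L ≤ v s → (v s : ℕ) < p → c ≤ e (v s) := by
      intro s h1 h2
      rcases (hw.le_iff.2 ⟨h1, h2.le.trans hpu⟩ : u ≤ s).eq_or_lt with rfl | hus
      · exact hc
      · exact hc.trans (he.2 s u hus)
    have i2 : blockCount Fin.val d L p c < blockCount Fin.val e L p c := by
      refine blockCount_lt (fun l hl hlp hcl => ?_) (x := v t) hLt htp (habove t hLt htp) htc
      by_cases hr : l ∈ Set.range v
      · obtain ⟨s, rfl⟩ := hr
        exact habove s hl hlp
      · rw [(hd l (Fin.lt_def.2 (hlp.trans_le hpk))).1 hr] at hcl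
        omega
    omega
  have e1 := blockCount_add Fin.val d c (Nat.zero_le p) (show p ≤ k + 1 by omega)
  have e2 := blockCount_add Fin.val e c (Nat.zero_le p) (show p ≤ k + 1 by omega)
  have i1 := hed (k + 1) c
  have i2 : blockCount Fin.val e p (k + 1) c < blockCount Fin.val d p (k + 1) c := by
    refine blockCount_lt (fun l hpl hlk hcl => ?_) (x := k) hpk (Nat.lt_succ_self _) hck ?_
    · by_contra! hdl
      by_cases hr : l ∈ Set.range v
      · obtain ⟨u, rfl⟩ := hr
        have hut := h.lt_of_lt hv hk (Fin.lt_def.2 (htp.trans_le hpl))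
          (Fin.le_def.2 (Nat.lt_succ_iff.1 hlk)) (Or.inr (by omega))
        have := hlow u hut hpl (Fin.le_def.2 (Nat.lt_succ_iff.1 hlk))
        omega
      · rw [he.1 l hr] at hcl
        omega
    · by_cases hr : k ∈ Set.range v
      · obtain ⟨u, rfl⟩ := hr
        exact hlow u (h.lt_of_lt hv hk h.lt le_rfl (Or.inl rfl)) hpk le_rfl
      · rw [he.1 k hr]
        omega
  omega

/-- Completing stage `k` makes an admissible composition dominant at position `k`, keeps it
admissible, moves it down in the Bruhat order, and keeps it above every dominant composition. -/
theorem bubbleStage_spec (hv : IsConsistentAntiLinearization v) (hd : ∀ l < k, IsDominantAt v l d)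
    (hadm : IsAdmissible v d) :
    (∀ l ≤ k, IsDominantAt v l (bubbleStage v k d)) ∧ IsAdmissible v (bubbleStage v k d) ∧
      BruhatLE (bubbleStage v k d) d ∧ (∃ σ : Equiv.Perm (Fin m), bubbleStage v k d = d ∘ σ) ∧
      ∀ e, IsDominant v e → PrefixLE Fin.val e d → PrefixLE Fin.val e (bubbleStage v k d) := by
  induction hn : d k using Nat.strong_induction_on generalizing d with
  | _ n ih =>
    by_cases hk : IsDominantAt v k d
    · rw [bubbleStage_of_isDominantAt hk]
      refine ⟨fun l hl => ?_, hadm, Relation.ReflTransGen.refl, ⟨1, rfl⟩, fun e _ h => h⟩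
      rcases hl.eq_or_lt with rfl | hl
      · exact hk
      · exact hd l hl
    · have hne := swapCandidates_nonempty hv hadm hk
      obtain ⟨t, ht, hsel⟩ := exists_isSelected hne
      rw [bubbleStage, dif_pos ⟨hk, hne⟩, ht]
      obtain ⟨h1, h2, h3, ⟨σ, h4⟩, h5⟩ := ih ((d ∘ Equiv.swap (v t) k) k)
        (by simpa [← hn] using hsel.entry_lt) (hsel.isDominantAt hv hd)
        (hsel.isAdmissible hv hd hadm) rfl
      refine ⟨h1, h2, h3.tail hsel.step, ⟨σ.trans (Equiv.swap (v t) k), ?_⟩, fun e he hed =>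
        h5 e he (hsel.prefixLE hv hd hk he hed)⟩
      rw [h4]
      rfl

/-- Bubble-sort sends an admissible composition `d` to the greatest dominant composition below
`d`. -/
theorem bubbleSort_spec (hv : IsConsistentAntiLinearization v) (hadm : IsAdmissible v d) :
    IsDominant v (bubbleSort v d) ∧ BruhatLE (bubbleSort v d) d ∧
      (∃ σ : Equiv.Perm (Fin m), bubbleSort v d = d ∘ σ) ∧
      ∀ e, IsDominant v e → PrefixLE Fin.val e d → PrefixLE Fin.val e (bubbleSort v d) := by
  have key : ∀ n ≤ m, ∃ b, ((List.finRange m).take n).foldl (fun e k => bubbleStage v k e) d = b ∧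
      (∀ l : Fin m, (l : ℕ) < n → IsDominantAt v l b) ∧ IsAdmissible v b ∧ BruhatLE b d ∧
      (∃ σ : Equiv.Perm (Fin m), b = d ∘ σ) ∧
      ∀ e, IsDominant v e → PrefixLE Fin.val e d → PrefixLE Fin.val e b := by
    intro n hn
    induction n with
    | zero =>
      exact ⟨d, rfl, fun l hl => absurd hl (Nat.not_lt_zero _), hadm, Relation.ReflTransGen.refl,
        ⟨1, rfl⟩, fun e _ h => h⟩
    | succ n ih =>
      obtain ⟨b, hb, h1, h2, h3, ⟨σ, h4⟩, h5⟩ := ih (by omega)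
      obtain ⟨g1, g2, g3, ⟨τ, g4⟩, g5⟩ := bubbleStage_spec (k := ⟨n, hn⟩) hv
        (fun l hl => h1 l hl) h2
      refine ⟨bubbleStage v ⟨n, hn⟩ b, ?_, fun l hl => g1 l (Nat.lt_succ_iff.1 hl), g2,
        Relation.ReflTransGen.trans g3 h3, ⟨τ.trans σ, by rw [g4, h4]; rfl⟩,
        fun e he hed => g5 e he (h5 e he hed)⟩
      rw [List.take_succ_eq_append_getElem (by simpa using hn), List.foldl_append, hb]
      simp
  obtain ⟨b, hb, h1, h2, h3, h4, h5⟩ := key m le_rfl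
  rw [List.take_of_length_le (by simp)] at hb
  have hb : bubbleSort v d = b := hb
  rw [hb]
  exact ⟨isDominant_iff.2 fun l => h1 l l.isLt, h3, h4, h5⟩

variable {lam : Fin m → ℕ}

/-- Bubble-sort as a map on admissible compositions. -/
noncomputable def bubbleMap (hv : IsConsistentAntiLinearization v) (d : AdmissiblePoset v lam) :
    AdmissiblePoset v lam :=
  ⟨⟨bubbleSort v d.val.val, by
    obtain ⟨σ, hσ⟩ := (bubbleSort_spec hv d.property).2.2.1
    obtain ⟨τ, hτ⟩ := d.val.rearrangement
    exact ⟨σ.trans τ, by rw [hσ, hτ]; rfl⟩⟩,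
    (bubbleSort_spec hv d.property).1.isAdmissible hv.injective⟩

theorem bubbleMap_monotone (hv : IsConsistentAntiLinearization v)
    (hlam : IsRegularPartition (Nat.card S) lam) :
    Monotone (bubbleMap hv : AdmissiblePoset v lam → AdmissiblePoset v lam) := by
  classical
  intro a b hab
  obtain ⟨ha, hle, -, -⟩ := bubbleSort_spec hv a.property
  obtain ⟨hb, -, -, hgreatest⟩ := bubbleSort_spec hv b.property
  have h := hgreatest _ ha (BruhatLE.prefixLE (Relation.ReflTransGen.trans hle hab))
  exact le_of_prefixLE hv hlam (x := ⟨(bubbleMap hv a).val, ha⟩) (y := ⟨(bubbleMap hv b).val, hb⟩)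
    ((prefixLE_entries_iff hv.injective).2 h)

end BubbleSort

end Arborescent

open Arborescent in
theorem theorem2p13 {S : Type*} [PartialOrder S] [Finite S] {m : ℕ} (v : S → Fin m)
    (hv : Arborescent.IsConsistentAntiLinearization v) (lam : Fin m → ℕ)
    (hlam : Arborescent.IsRegularPartition (Nat.card S) lam) :
    -- exchanging the entries of a minimal disorder preserves dominance
    (∀ (a : Arborescent.DominantPoset v lam) (s t : S),
      Arborescent.IsMinimalDisorder v a.val.val s t →
        Arborescent.IsDominant v (a.val.val ∘ Equiv.swap (v s) (v t))) ∧
    -- covering relations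
    (∀ a b : Arborescent.DominantPoset v lam, a ⋖ b ↔
      ∃ s t : S, Arborescent.IsMinimalDisorder v a.val.val s t ∧
        b.val.val = a.val.val ∘ Equiv.swap (v s) (v t)) ∧
    -- order-theoretic properties
    Arborescent.IsBoundedPoset (Arborescent.DominantPoset v lam) ∧
    Arborescent.IsGradedPoset (Arborescent.DominantPoset v lam) ∧
    Arborescent.IsRankFunction
      (fun d : Arborescent.DominantPoset v lam => Arborescent.disorderRank v d.val.val) ∧
    Arborescent.IsSubthin (Arborescent.DominantPoset v lam) ∧
    Arborescent.IsELShellable (Arborescent.DominantPoset v lam) ∧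
    -- bubble-sort from the admissible compositions (the whole orbit if `v` is surjective)
    -- onto the dominant ones
    (∀ d : Arborescent.Orbit lam, Arborescent.IsDominant v d.val →
      Arborescent.IsAdmissible v d.val) ∧
    (Function.Surjective v → ∀ d : Arborescent.Orbit lam, Arborescent.IsAdmissible v d.val) ∧
    ∃ F : Arborescent.AdmissiblePoset v lam → Arborescent.AdmissiblePoset v lam,
      (∀ d, (F d).val.val = Arborescent.bubbleSort v d.val.val) ∧
      Monotone F ∧
      (∀ d, F d ≤ d) ∧
      (∀ d, F (F d) = F d) ∧
      Set.range F = {d | Arborescent.IsDominant v d.val.val} := by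
  classical
  have hfix : ∀ d : AdmissiblePoset v lam, IsDominant v d.val.val → bubbleMap hv d = d :=
    fun d hd => Subtype.ext (Orbit.ext (bubbleSort_of_isDominant hd))
  have hdom : ∀ d : AdmissiblePoset v lam, IsDominant v (bubbleMap hv d).val.val :=
    fun d => (bubbleSort_spec hv d.property).1
  refine ⟨fun a s t h => ?_, fun a b => ?_, isBoundedPoset hv hlam, isGradedPoset hv hlam,
    isRankFunction hv hlam, isSubthin hv hlam, isELShellable hv hlam,
    fun d hd => hd.isAdmissible hv.injective,
    fun hsurj d => isAdmissible_of_surjective hsurj hv.injective,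
    bubbleMap hv, fun d => rfl, bubbleMap_monotone hv hlam,
    fun d => (bubbleSort_spec hv d.property).2.1, fun d => hfix _ (hdom d), ?_⟩
  · convert isDominant_comp_swap hv.injective a
      (((isMinimalDisorder_iff hv hlam a).1 h).monotone_comp_swap hv.isPostorder
        (entries_monotone a))
  · rw [covBy_iff hv hlam]
    simp only [isMinimalDisorder_iff hv hlam, val_eq_comp_swap_iff hv.injective]
  · ext d
    exact ⟨fun ⟨d', h⟩ => h ▸ hdom d', fun h => ⟨d, hfix d h⟩⟩
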